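/- Let $n\ge 1$ and $V_0^n=\{x\in\mathbb R^n: x_1+\cdots+x_n=0\}$, with its Lebesgue measure. An ordered set partition $(S_1,\dots,S_k)$ of $J\subseteq\{1,\dots,n\}$ is a sequence of nonempty, pairwise disjoint blocks with union $J$. Its plate $[S_1,\dots,S_k]$ is the cone of all $x\in V_0^n$ with $x_j=0$ for $j\notin J$ and $\sum_{j\in S_1\cup\cdots\cup S_q}x_j\ge 0$ for $1\le q<k$; $[[S_1,\dots,S_k]]$ denotes its characteristic function, and $p_a<p_b$ means that the block of $a$ is strictly to the left of the block of $b$. A composite set partition $\{\mathbf T_1,\dots,\mathbf T_m\}$ of $\{1,\dots,n\}$ consists of one ordered set partition $\mathbf T_j$ of every part $J_j$ of an unordered set partition $\{J_1,\dots,J_m\}$ of $\{1,\dots,n\}$. The convolution product $[[\mathbf T_1]]\bullet\cdots\bullet[[\mathbf T_m]]$ is the characteristic function of the Minkowski sum of the plates $[\mathbf T_1],\dots,[\mathbf T_m]$. Let $\hat{\mathcal P}^n$ be the complex linear span of the characteristic functions (on $V_0^n$) of the plates labeled by ordered set partitions of $\{1,\dots,n\}$, let $\hat{\mathcal P}_1^n$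 be its quotient by the span of the characteristic functions of those of these plates which are not pointed (i.e. contain a line), and let $\mathcal P_1^n$ be its quotient by the span of these functions together with all elements of $\hat{\mathcal P}^n$ which vanish outside a set of measure zero in $V_0^n$. Let $(i_1,\dots,i_n)$ be a permutation of $\{1,\dots,n\}$ and $1\le l\le n$; write $[[i_l,\dots,i_1,i_{l+1},\dots,i_n]]$ for the characteristic function of the plate with the singlet blocks $\{i_l\},\dots,\{i_1\},\{i_{l+1}\},\dots,\{i_n\}$, in this order. Consider the orientations $$p_{i_l}>p_{i_{l-1}}>\cdots>p_{i_1}<p_{i_{l+1}}<\cdots<p_{i_n}.\qquad(*)$$ A composite set partition is said to satisfy $(*)$ if - $i_1,i_{l+1},\dots,i_n$ are labels of the same $\mathbf T_j$, where $p_{i_1}<p_{i_{l+1}}<\cdots<p_{i_n}$; and - whenever $1\le a<b\le l$ and $i_a,i_b$ are labels of the same $\mathbf T_j$, then $p_{i_a}<p_{i_b}$ there, and $i_c$ is a label of the same $\mathbf T_j$ for all $a<c<b$. All convolution products $[[\mathbf T_1]]\bullet\cdots\bullet[[\mathbf T_m]]$ labeled by composite set partitions of $\{1,\dots,n\}$ lie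 in $\hat{\mathcal P}^n$, and the following hold. 1. In $\hat{\mathcal P}_1^n$, $$[[i_l,\dots,i_1,i_{l+1},\dots,i_n]]=\sum_{m=1}^n\ \sum_{\{\mathbf T_1,\dots,\mathbf T_m\}}(-1)^{l-m}\,[[\mathbf T_1]]\bullet\cdots\bullet[[\mathbf T_m]],$$ where the inner sum is over all composite set partitions of $\{1,\dots,n\}$ with $m$ members and with all blocks singlets which satisfy $(*)$. 2. In $\mathcal P_1^n$, $$[[i_l,\dots,i_1,i_{l+1},\dots,i_n]]=(-1)^{l-1}\sum_{\pi}[\pi],$$ where $[\pi]$ is the characteristic function of the plate $\pi$, and the sum is over all plates $\pi$ labeled by ordered set partitions of $\{1,\dots,n\}$ with all blocks singlets which satisfy $(*)$. All ordered set partitions and composite set partitions which occur in these sums are standard with respect to the order $i_1<i_2<\cdots<i_n$ of the labels: the first block of each ordered set partition contains its first label in this order. -/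

import Mathlib

open scoped Pointwise

/-- The hyperplane `x₁ + ⋯ + xₙ = 0` in Euclidean space `ℝⁿ`; the labels `1, …, n` are the
elements of `Fin n`.  It carries the induced inner product and the induced Lebesgue measure. -/
def V0 (n : ℕ) : Submodule ℝ (EuclideanSpace ℝ (Fin n)) where
  carrier := {x | ∑ i, x i = 0}
  add_mem' := by
    intro a b ha hb
    simp only [Set.mem_ofPred_eq, PiLp.add_apply, Finset.sum_add_distrib] at *
    rw [ha, hb, add_zero]
  zero_mem' := by simp
  smul_mem' := by
    intro c x hx
    simp only [Set.mem_ofPred_eq, PiLp.smul_apply, smul_eq_mul, ← Finset.mul_sum] at *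
    rw [hx, mul_zero]

/-- An ordered set partition `(S₁, …, S_k)` of a set `J` of labels: nonempty, pairwise disjoint
blocks with union `J`.  The block `S_{q+1}` is `block q`. -/
@[ext]
structure OrderedSetPartition {n : ℕ} (J : Finset (Fin n)) where
  len : ℕ
  block : Fin len → Finset (Fin n)
  nonempty : ∀ q, (block q).Nonempty
  disjoint : ∀ q r, q ≠ r → Disjoint (block q) (block r)
  union : ∀ a, a ∈ J ↔ ∃ q, a ∈ block q

namespace OrderedSetPartition

variable {n : ℕ} {J : Finset (Fin n)}

lemma len_le (P : OrderedSetPartition J) : P.len ≤ n := by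
  choose f hf using P.nonempty
  have hinj : Function.Injective f := by
    intro q r h
    by_contra hne
    exact Finset.disjoint_left.mp (P.disjoint q r hne) (hf q) (h ▸ hf r)
  simpa using Fintype.card_le_of_injective f hinj

instance : Finite (OrderedSetPartition J) := by
  let F : OrderedSetPartition J → Σ k : Fin (n + 1), (Fin k → Finset (Fin n)) :=
    fun P => ⟨⟨P.len, Nat.lt_succ_of_le P.len_le⟩, P.block⟩
  refine Finite.of_injective F ?_
  rintro ⟨k, b, _, _, _⟩ ⟨k', b', _, _, _⟩ h
  simp only [F, Sigma.mk.injEq, Fin.mk.injEq] at h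
  obtain ⟨rfl, h⟩ := h
  simp only [heq_eq_eq] at h
  subst h
  rfl

/-- The orientation `p_a < p_b`: the block containing `a` is strictly to the left of the block
containing `b`. -/
def Lt (P : OrderedSetPartition J) (a b : Fin n) : Prop :=
  ∃ q r : Fin P.len, q < r ∧ a ∈ P.block q ∧ b ∈ P.block r

/-- All blocks are singlets. -/
def AllSinglets (P : OrderedSetPartition J) : Prop :=
  ∀ q, (P.block q).card = 1

/-- The plate `[S₁, …, S_k]`, as a cone in `V0 n`: coordinates outside of
`J = S₁ ∪ ⋯ ∪ S_k` vanish, and `x_{S₁ ∪ ⋯ ∪ S_q} ≥ 0` for `q = 1, …, k - 1`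
(and `x_{S₁ ∪ ⋯ ∪ S_k} = 0` holds because `x ∈ V0 n`). -/
def plate (P : OrderedSetPartition J) : Set (V0 n) :=
  {x | (∀ a, a ∉ J → (x : EuclideanSpace ℝ (Fin n)) a = 0) ∧
    ∀ q : Fin P.len, (q : ℕ) + 1 < P.len →
      0 ≤ ∑ r ∈ Finset.Iic q, ∑ a ∈ P.block r, (x : EuclideanSpace ℝ (Fin n)) a}

/-- The first block contains the minimal label of `J`, for the total order
`i₁ < i₂ < ⋯ < iₙ` of the labels given by the enumeration `i` (`i_{a+1}` is `i a`). -/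
def IsStandard (i : Equiv.Perm (Fin n)) (P : OrderedSetPartition J) : Prop :=
  ∀ a : Fin n, i a ∈ J → (∀ b : Fin n, i b ∈ J → a ≤ b) →
    ∃ h : 0 < P.len, i a ∈ P.block ⟨0, h⟩

/-- The ordered set partition `({w₁}, …, {wₙ})` of all labels, for a permutation `w`. -/
def ofPerm (w : Equiv.Perm (Fin n)) : OrderedSetPartition (Finset.univ : Finset (Fin n)) where
  len := n
  block q := {w q}
  nonempty q := Finset.singleton_nonempty _
  disjoint q r h := by simpa using h
  union a := by
    simp only [Finset.mem_univ, Finset.mem_singleton, true_iff]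
    exact ⟨w.symm a, by simp⟩

/-- The orientations `p_{i_l} > p_{i_{l-1}} > ⋯ > p_{i_1} < p_{i_{l+1}} < ⋯ < p_{i_n}`
of an ordered set partition; here `i_{a+1}` is `i a`. -/
def Oriented (i : Equiv.Perm (Fin n)) (l : ℕ) (P : OrderedSetPartition J) : Prop :=
  (∀ a b : Fin n, a < b → (b : ℕ) < l → P.Lt (i a) (i b)) ∧
  (∀ a b : Fin n, a < b → ((a : ℕ) = 0 ∨ l ≤ (a : ℕ)) → l ≤ (b : ℕ) → P.Lt (i a) (i b))

end OrderedSetPartition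

/-- A composite set partition `{𝐓₁, …, 𝐓_m}`: an unordered set partition `{J₁, …, J_m}` of the
labels, together with an ordered set partition of every `J_j`. -/
structure CompositeSetPartition (n : ℕ) where
  support : Finpartition (Finset.univ : Finset (Fin n))
  part : ∀ J : support.parts, OrderedSetPartition (J : Finset (Fin n))

namespace CompositeSetPartition

variable {n : ℕ}

instance : Finite (CompositeSetPartition n) := by
  let F : CompositeSetPartition n →
      Σ s : Finpartition (Finset.univ : Finset (Fin n)),
        ∀ J : s.parts, OrderedSetPartition (J : Finset (Fin n)) :=
    fun T => ⟨T.support, T.part⟩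
  refine Finite.of_injective F ?_
  rintro ⟨s, p⟩ ⟨s', p'⟩ h
  simp only [F, Sigma.mk.injEq] at h
  obtain ⟨rfl, h⟩ := h
  simp only [heq_eq_eq] at h
  rw [h]

/-- The number `m` of ordered set partitions in `{𝐓₁, …, 𝐓_m}`. -/
def size (T : CompositeSetPartition n) : ℕ := T.support.parts.card

/-- All blocks of all `𝐓_j` are singlets. -/
def AllSinglets (T : CompositeSetPartition n) : Prop :=
  ∀ J, (T.part J).AllSinglets

/-- All `𝐓_j` are standard for the order `i₁ < ⋯ < iₙ` of the labels. -/
def IsStandard (i : Equiv.Perm (Fin n)) (T : CompositeSetPartition n) : Prop :=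
  ∀ J, (T.part J).IsStandard i

/-- `a` and `b` are labels of the same ordered set partition `𝐓_j`. -/
def SamePart (T : CompositeSetPartition n) (a b : Fin n) : Prop :=
  ∃ J ∈ T.support.parts, a ∈ J ∧ b ∈ J

/-- `a` and `b` are in the same `𝐓_j`, and `p_a < p_b` there. -/
def Lt (T : CompositeSetPartition n) (a b : Fin n) : Prop :=
  ∃ J, (T.part J).Lt a b

/-- The orientations `p_{i_l} > p_{i_{l-1}} > ⋯ > p_{i_1} < p_{i_{l+1}} < ⋯ < p_{i_n}`
of a composite set partition; here `i_{a+1}` is `i a`.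

The labels `i_1, i_{l+1}, …, i_n` are in one and the same `𝐓_j`, in this order.  The labels
`i_1, …, i_l` may be spread over several `𝐓_j`, which cut the sequence `(i_1, …, i_l)` into runs
of consecutive terms, and the labels of each run appear in this order in their `𝐓_j`. -/
def Oriented (i : Equiv.Perm (Fin n)) (l : ℕ) (T : CompositeSetPartition n) : Prop :=
  (∀ a b : Fin n, a < b → (b : ℕ) < l → T.SamePart (i a) (i b) →
    T.Lt (i a) (i b) ∧ ∀ c : Fin n, a < c → c < b → T.SamePart (i a) (i c)) ∧
  (∀ a b : Fin n, a < b → ((a : ℕ) = 0 ∨ l ≤ (a : ℕ)) → l ≤ (b : ℕ) → T.Lt (i a) (i b))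

end CompositeSetPartition

/-- The characteristic function `[C]` of a subset of `V0 n`. -/
noncomputable def charFn {n : ℕ} (C : Set (V0 n)) : V0 n → ℂ :=
  C.indicator (fun _ => 1)

/-- The convolution product `[[𝐓₁]] • ⋯ • [[𝐓_m]]`: the characteristic function of the
Minkowski sum of the plates `[𝐓₁], …, [𝐓_m]`. -/
noncomputable def convolution {n : ℕ} (T : CompositeSetPartition n) : V0 n → ℂ :=
  charFn (∑ J, (T.part J).plate)

/-- The set contains no line which extends to infinity in both directions. -/
def IsPointed {n : ℕ} (C : Set (V0 n)) : Prop :=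
  ∀ p v : V0 n, v ≠ 0 → ∃ t : ℝ, p + t • v ∉ C

/-- The space `𝒫̂ⁿ`, spanned by the characteristic functions of all plates which are labeled by
ordered set partitions of the whole set of labels. -/
noncomputable def PHat (n : ℕ) : Submodule ℂ (V0 n → ℂ) :=
  Submodule.span ℂ
    (Set.range fun P : OrderedSetPartition (Finset.univ : Finset (Fin n)) => charFn P.plate)

/-- `[[S₁, …, S_k]]` as an element of `𝒫̂ⁿ`. -/
noncomputable def plateFun {n : ℕ} (P : OrderedSetPartition (Finset.univ : Finset (Fin n))) :
    PHat n :=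
  ⟨charFn P.plate, Submodule.subset_span ⟨P, rfl⟩⟩

/-- The span, in `𝒫̂ⁿ`, of the characteristic functions of the plates which are not pointed. -/
noncomputable def nonPointedSpan (n : ℕ) : Submodule ℂ (PHat n) :=
  Submodule.span ℂ
    {f | ∃ P : OrderedSetPartition (Finset.univ : Finset (Fin n)),
      ¬ IsPointed P.plate ∧ f = plateFun P}

/-- The elements of `𝒫̂ⁿ` which vanish outside of a set of measure zero in `V0 n`. -/
noncomputable def nullSpan (n : ℕ) : Submodule ℂ (PHat n) where
  carrier := {f | (f : V0 n → ℂ) =ᵐ[MeasureTheory.volume] 0}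
  add_mem' := by
    intro f g hf hg
    simp only [Set.mem_ofPred_eq, Submodule.coe_add] at *
    simpa using hf.add hg
  zero_mem' := by
    simp only [Set.mem_ofPred_eq, Submodule.coe_zero]
    exact Filter.EventuallyEq.rfl
  smul_mem' := by
    intro c f hf
    simp only [Set.mem_ofPred_eq, Submodule.coe_smul] at *
    simpa using hf.const_smul c

/-- The quotient `𝒫̂₁ⁿ` of `𝒫̂ⁿ`. -/
abbrev PHatOne (n : ℕ) := PHat n ⧸ nonPointedSpan n

/-- The quotient `𝒫₁ⁿ` of `𝒫̂ⁿ`. -/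
abbrev POne (n : ℕ) := PHat n ⧸ (nonPointedSpan n ⊔ nullSpan n)

/-- The involution of the positions `0, …, n - 1` which reverses the first `l` of them. -/
def reverseFirst {n : ℕ} (l : ℕ) (hl : l ≤ n) : Equiv.Perm (Fin n) :=
  Function.Involutive.toPerm
    (fun q : Fin n => ⟨if (q : ℕ) < l then l - 1 - q else q, by split_ifs <;> omega⟩)
    (by
      intro q
      ext
      dsimp only
      split_ifs <;> omega)

/-- The ordered set partition `(i_l, i_{l-1}, …, i_1, i_{l+1}, …, i_n)` into singlets; here
`i_{a+1}` is `i a`. -/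
def valley {n : ℕ} (i : Equiv.Perm (Fin n)) (l : ℕ) (hl : l ≤ n) :
    OrderedSetPartition (Finset.univ : Finset (Fin n)) :=
  OrderedSetPartition.ofPerm ((reverseFirst l hl).trans i)

/-- The finite set of composite set partitions into singlets with the orientations
`p_{i_l} > ⋯ > p_{i_1} < p_{i_{l+1}} < ⋯ < p_{i_n}`. -/
noncomputable def orientedComposites {n : ℕ} (i : Equiv.Perm (Fin n)) (l : ℕ) :
    Finset (CompositeSetPartition n) :=
  (Set.toFinite {T : CompositeSetPartition n | T.AllSinglets ∧ T.Oriented i l}).toFinset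

/-- The finite set of ordered set partitions into singlets with the orientations
`p_{i_l} > ⋯ > p_{i_1} < p_{i_{l+1}} < ⋯ < p_{i_n}`. -/
noncomputable def orientedPartitions {n : ℕ} (i : Equiv.Perm (Fin n)) (l : ℕ) :
    Finset (OrderedSetPartition (Finset.univ : Finset (Fin n))) :=
  (Set.toFinite {P : OrderedSetPartition (Finset.univ : Finset (Fin n)) |
    P.AllSinglets ∧ P.Oriented i l}).toFinset

/-! The computation takes place modulo the plates having a block with at least two labels, called
lumped below. They contain lines, so they vanish in both quotients.

A point of a Minkowski sum of plates on complementary parts has sum zero over every part.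
Conversely, nonnegative part sums are all zero, because they add up to zero. Hence a convolution
product is the pointwise product of the functions `coneFun` of its factors (`convolution_eq_prod`).

Such products obey a quasi-shuffle rule. Let H_J be the indicator of x_J ≥ 0. For disjoint J and K,
H_J H_K = H_{J ∪ K} (H_J + H_K - 1). Used recursively on the last blocks, this expands every product
into plates, so convolution products lie in `PHat n`. The term with -1 merges two last blocks and is
lumped. Modulo lumped plates, a convolution product of singlets is therefore the sum of the plates
of all permutations w extending its partial order (`convolution_sub_mem`).

It remains to find the coefficient of each w on the right-hand side (`sum_compatible`). A composite
satisfying (*) and compatible with w is determined by the set E of positions among those of i_1, …,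
i_l whose label shares the part of its predecessor, and m = l - |E|. If i_1, i_{l+1}, …, i_n are in
this order in w, then E runs through all subsets of the ascents of (i_1, …, i_l) in w; otherwise
there is no such composite. The sum of (-1)^|E| is 0 unless there are no ascents. In that case w is
(i_l, …, i_1, i_{l+1}, …, i_n), with coefficient 1.

For the second identity, a product of m ≥ 2 plates is supported on a hyperplane, so only m = 1
survives, with sign (-1)^(l-1). -/

/-- The indicator function of the half space `∑ a ∈ K, x a ≥ 0` of `V0 n`. -/
noncomputable def halfSpaceFun {n : ℕ} (K : Finset (Fin n)) : V0 n → ℂ :=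
  open Classical in
  fun x => if 0 ≤ ∑ a ∈ K, (x : EuclideanSpace ℝ (Fin n)) a then 1 else 0

/-! ### Cones built by appending a last block -/

namespace OrderedSetPartition

variable {n : ℕ} {J : Finset (Fin n)}

/-- The sum of the coordinates over the first `q + 1` blocks. -/
noncomputable def prefixSum (P : OrderedSetPartition J) (q : Fin P.len) (x : V0 n) : ℝ :=
  ∑ r ∈ Finset.Iic q, ∑ a ∈ P.block r, (x : EuclideanSpace ℝ (Fin n)) a

/-- The indicator function of the set where all prefix sums, including the last one, are
nonnegative. -/
noncomputable def coneFun (P : OrderedSetPartition J) : V0 n → ℂ :=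
  open Classical in
  fun x => if ∀ q, 0 ≤ P.prefixSum q x then 1 else 0

lemma sum_block (P : OrderedSetPartition J) (f : Fin n → ℝ) :
    ∑ r, ∑ a ∈ P.block r, f a = ∑ a ∈ J, f a := by
  classical
  rw [← Finset.sum_biUnion]
  · congr 1
    ext a
    simp [P.union a]
  · intro q _ r _ h
    exact P.disjoint q r h

lemma eq_of_mem_block (P : OrderedSetPartition J) {q r : Fin P.len} {a : Fin n}
    (hq : a ∈ P.block q) (hr : a ∈ P.block r) : q = r := by
  by_contra h
  exact Finset.disjoint_left.mp (P.disjoint q r h) hq hr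

lemma Lt.mem_left {P : OrderedSetPartition J} {a b : Fin n} (h : P.Lt a b) : a ∈ J := by
  obtain ⟨q, r, _, ha, _⟩ := h
  exact (P.union a).2 ⟨q, ha⟩

lemma Lt.mem_right {P : OrderedSetPartition J} {a b : Fin n} (h : P.Lt a b) : b ∈ J := by
  obtain ⟨q, r, _, _, hb⟩ := h
  exact (P.union b).2 ⟨r, hb⟩

lemma Lt.asymm {P : OrderedSetPartition J} {a b : Fin n} (h : P.Lt a b) : ¬ P.Lt b a := by
  obtain ⟨q, r, hqr, ha, hb⟩ := h
  rintro ⟨q', r', hqr', hb', ha'⟩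
  obtain rfl := P.eq_of_mem_block ha ha'
  obtain rfl := P.eq_of_mem_block hb hb'
  exact lt_asymm hqr hqr'

lemma Lt.ne {P : OrderedSetPartition J} {a b : Fin n} (h : P.Lt a b) : a ≠ b := by
  rintro rfl
  exact h.asymm h

lemma AllSinglets.lt_or_lt {P : OrderedSetPartition J} (h : P.AllSinglets) {a b : Fin n}
    (ha : a ∈ J) (hb : b ∈ J) (hab : a ≠ b) : P.Lt a b ∨ P.Lt b a := by
  obtain ⟨q, hq⟩ := (P.union a).1 ha
  obtain ⟨r, hr⟩ := (P.union b).1 hb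
  rcases lt_trichotomy q r with hqr | rfl | hqr
  · exact Or.inl ⟨q, r, hqr, hq, hr⟩
  · exact absurd (Finset.card_le_one.1 (h q).le a hq b hr) hab
  · exact Or.inr ⟨r, q, hqr, hr, hq⟩

/-- Append a last block. -/
def snoc {K : Finset (Fin n)} (P : OrderedSetPartition K) (S : Finset (Fin n)) (hS : S.Nonempty)
    (hK : Disjoint K S) (hJ : ∀ a, a ∈ J ↔ a ∈ K ∨ a ∈ S) : OrderedSetPartition J where
  len := P.len + 1
  block := Fin.snoc (α := fun _ => Finset (Fin n)) P.block S
  nonempty q := by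
    induction q using Fin.lastCases with
    | last => simpa using hS
    | cast q => simpa using P.nonempty q
  disjoint q r h := by
    have key : ∀ q, Disjoint (P.block q) S := fun q =>
      hK.mono_left fun a ha => (P.union a).2 ⟨q, ha⟩
    induction q using Fin.lastCases with
    | last =>
      induction r using Fin.lastCases with
      | last => exact absurd rfl h
      | cast r => simpa using (key r).symm
    | cast q =>
      induction r using Fin.lastCases with
      | last => simpa using key q
      | cast r => simpa using P.disjoint q r (fun e => h (by rw [e]))
  union a := by
    rw [hJ, P.union, Fin.exists_fin_succ']
    simp

/-- The last prefix sum runs over all of `J`, so a new last block contributes exactly one half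
space. The recursions below peel off last blocks through this factorization. -/
lemma coneFun_eq_of_snoc {K : Finset (Fin n)} (P : OrderedSetPartition K) {S : Finset (Fin n)}
    (hS : S.Nonempty) (hK : Disjoint K S) (hJ : ∀ a, a ∈ J ↔ a ∈ K ∨ a ∈ S) :
    (P.snoc S hS hK hJ).coneFun = halfSpaceFun J * P.coneFun := by
  classical
  funext x
  have h1 : ∀ q : Fin P.len, (P.snoc S hS hK hJ).prefixSum (Fin.castSucc q) x = P.prefixSum q x := by
    intro q
    unfold prefixSum
    change ∑ r ∈ Finset.Iic (Fin.castSucc q), ∑ a ∈ (Fin.snoc (α := fun _ => Finset (Fin n))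
      P.block S : Fin (P.len + 1) → _) r, _ = _
    rw [← Fin.map_castSuccEmb_Iic, Finset.sum_map]
    simp
  have h2 : (P.snoc S hS hK hJ).prefixSum (Fin.last P.len) x
      = ∑ a ∈ J, (x : EuclideanSpace ℝ (Fin n)) a := by
    rw [← sum_block (P.snoc S hS hK hJ)]
    unfold prefixSum
    rw [← Fin.top_eq_last]
    change ∑ r ∈ Finset.Iic (⊤ : Fin (P.len + 1)), _ = _
    rw [Finset.Iic_top]
    rfl
  have h3 : (∀ q, 0 ≤ (P.snoc S hS hK hJ).prefixSum q x) ↔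
      0 ≤ ∑ a ∈ J, (x : EuclideanSpace ℝ (Fin n)) a ∧ ∀ q, 0 ≤ P.prefixSum q x := by
    change (∀ q : Fin (P.len + 1), _) ↔ _
    rw [Fin.forall_fin_succ', h2, and_comm]
    simp only [h1]
  simp only [coneFun, halfSpaceFun, Pi.mul_apply, h3, ite_and, mul_ite, mul_one, mul_zero]
  split_ifs <;> rfl

lemma snoc_lt_iff {K : Finset (Fin n)} (P : OrderedSetPartition K) {S : Finset (Fin n)}
    (hS : S.Nonempty) (hK : Disjoint K S) (hJ : ∀ a, a ∈ J ↔ a ∈ K ∨ a ∈ S) (a b : Fin n) :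
    (P.snoc S hS hK hJ).Lt a b ↔ P.Lt a b ∨ (a ∈ K ∧ b ∈ S) := by
  unfold Lt
  change (∃ q r : Fin (P.len + 1), q < r ∧ a ∈ (Fin.snoc (α := fun _ => Finset (Fin n))
      P.block S : Fin (P.len + 1) → _) q ∧ b ∈ (Fin.snoc (α := fun _ => Finset (Fin n))
      P.block S : Fin (P.len + 1) → _) r) ↔ _
  simp only [Fin.exists_fin_succ', Fin.snoc_castSucc, Fin.snoc_last, Fin.castSucc_lt_castSucc_iff,
    Fin.castSucc_lt_last, true_and, lt_irrefl, false_and, or_false, P.union a]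
  constructor
  · rintro (⟨q, ⟨r, h⟩ | h⟩ | ⟨r, h, _⟩)
    · exact Or.inl ⟨q, r, h⟩
    · exact Or.inr ⟨⟨q, h.1⟩, h.2⟩
    · exact absurd h (Fin.castSucc_lt_last r).asymm
  · rintro (⟨q, r, h⟩ | ⟨⟨q, h⟩, h'⟩)
    · exact Or.inl ⟨q, Or.inl ⟨r, h⟩⟩
    · exact Or.inl ⟨q, Or.inr ⟨h, h'⟩⟩

lemma snoc_allSinglets_iff {K : Finset (Fin n)} (P : OrderedSetPartition K) {S : Finset (Fin n)}
    (hS : S.Nonempty) (hK : Disjoint K S) (hJ : ∀ a, a ∈ J ↔ a ∈ K ∨ a ∈ S) :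
    (P.snoc S hS hK hJ).AllSinglets ↔ P.AllSinglets ∧ S.card = 1 := by
  unfold AllSinglets
  change (∀ q : Fin (P.len + 1), ((Fin.snoc (α := fun _ => Finset (Fin n))
      P.block S : Fin (P.len + 1) → _) q).card = 1) ↔ _
  simp [Fin.forall_fin_succ']

lemma exists_eq_snoc (P : OrderedSetPartition J) (hJ : J.Nonempty) :
    ∃ (K S : Finset (Fin n)) (P' : OrderedSetPartition K) (hS : S.Nonempty) (hK : Disjoint K S)
      (h : ∀ a, a ∈ J ↔ a ∈ K ∨ a ∈ S), P = P'.snoc S hS hK h := by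
  classical
  obtain ⟨len, block, nonempty, disjoint, union⟩ := P
  obtain _ | k := len
  · obtain ⟨a, ha⟩ := hJ
    obtain ⟨q, _⟩ := (union a).1 ha
    exact q.elim0
  · refine ⟨Finset.univ.biUnion fun q : Fin k => block q.castSucc, block (Fin.last k),
      ⟨k, fun q => block q.castSucc, fun q => nonempty _, fun q r h => disjoint _ _ (by simpa using h),
        fun a => by simp⟩, nonempty _, ?_, ?_, ?_⟩
    · rw [Finset.disjoint_biUnion_left]
      intro q _
      exact disjoint _ _ (Fin.castSucc_lt_last q).ne
    · intro a
      rw [union a, Fin.exists_fin_succ']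
      simp
    · simp only [snoc]
      congr 1
      exact (Fin.snoc_init_self block).symm

lemma coneFun_empty (P : OrderedSetPartition (∅ : Finset (Fin n))) : P.coneFun = 1 := by
  funext x
  have : IsEmpty (Fin P.len) := ⟨fun q => by
    obtain ⟨a, ha⟩ := P.nonempty q
    exact absurd ((P.union a).2 ⟨q, ha⟩) (Finset.notMem_empty a)⟩
  simp [coneFun]

lemma allSinglets_empty (P : OrderedSetPartition (∅ : Finset (Fin n))) : P.AllSinglets := by
  intro q
  obtain ⟨a, ha⟩ := P.nonempty q
  exact absurd ((P.union a).2 ⟨q, ha⟩) (Finset.notMem_empty a)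

end OrderedSetPartition

/-! ### Quasi-shuffle products of cone functions -/

section Spans

variable {n : ℕ}

/-- The span of the cone functions of all ordered set partitions of `J`. -/
noncomputable def coneSpan (J : Finset (Fin n)) : Submodule ℂ (V0 n → ℂ) :=
  Submodule.span ℂ (Set.range fun P : OrderedSetPartition J => P.coneFun)

/-- The span of the cone functions of the ordered set partitions of `J` with a block which is not
a singlet. -/
noncomputable def lumpedSpan (J : Finset (Fin n)) : Submodule ℂ (V0 n → ℂ) :=
  Submodule.span ℂ {f | ∃ P : OrderedSetPartition J, ¬ P.AllSinglets ∧ P.coneFun = f}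

lemma coneFun_mem_coneSpan {J : Finset (Fin n)} (P : OrderedSetPartition J) :
    P.coneFun ∈ coneSpan J :=
  Submodule.subset_span ⟨P, rfl⟩

lemma coneFun_mem_lumpedSpan {J : Finset (Fin n)} (P : OrderedSetPartition J)
    (h : ¬ P.AllSinglets) : P.coneFun ∈ lumpedSpan J :=
  Submodule.subset_span ⟨P, h, rfl⟩

lemma lumpedSpan_le_coneSpan (J : Finset (Fin n)) : lumpedSpan J ≤ coneSpan J := by
  refine Submodule.span_mono ?_
  rintro _ ⟨P, -, rfl⟩
  exact ⟨P, rfl⟩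

lemma one_mem_coneSpan_empty : (1 : V0 n → ℂ) ∈ coneSpan (∅ : Finset (Fin n)) := by
  let P : OrderedSetPartition (∅ : Finset (Fin n)) :=
    ⟨0, fun q => q.elim0, fun q => q.elim0, fun q => q.elim0, fun a => by simp⟩
  rw [← P.coneFun_empty]
  exact coneFun_mem_coneSpan P

/-- If left multiplication by `g` maps the generators into a submodule, it maps the span there. -/
lemma mul_mem_of_mem_span {A : Type*} {s : Set (A → ℂ)} {N : Submodule ℂ (A → ℂ)} {g : A → ℂ}
    (h : ∀ f ∈ s, g * f ∈ N) {f : A → ℂ} (hf : f ∈ Submodule.span ℂ s) : g * f ∈ N := by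
  have : Submodule.span ℂ s ≤ N.comap (LinearMap.mulLeft ℂ g) := Submodule.span_le.2 h
  exact this hf

variable {J K S : Finset (Fin n)}

lemma halfSpaceFun_mul_mem_coneSpan (hS : S.Nonempty) (hK : Disjoint K S)
    (hJ : ∀ a, a ∈ J ↔ a ∈ K ∨ a ∈ S) {f : V0 n → ℂ} (hf : f ∈ coneSpan K) :
    halfSpaceFun J * f ∈ coneSpan J := by
  refine mul_mem_of_mem_span ?_ hf
  rintro _ ⟨P, rfl⟩
  change _ * P.coneFun ∈ _
  rw [← P.coneFun_eq_of_snoc hS hK hJ]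
  exact coneFun_mem_coneSpan _

lemma halfSpaceFun_mul_mem_lumpedSpan (hS : S.Nonempty) (hK : Disjoint K S)
    (hJ : ∀ a, a ∈ J ↔ a ∈ K ∨ a ∈ S) {f : V0 n → ℂ} (hf : f ∈ lumpedSpan K) :
    halfSpaceFun J * f ∈ lumpedSpan J := by
  refine mul_mem_of_mem_span ?_ hf
  rintro _ ⟨P, hP, rfl⟩
  rw [← P.coneFun_eq_of_snoc hS hK hJ]
  refine coneFun_mem_lumpedSpan _ ?_
  rw [P.snoc_allSinglets_iff]
  exact fun h => hP h.1

/-- The half space appends the block `S`, which is not a singlet; this makes every generator lumped,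
whatever it was before. -/
lemma halfSpaceFun_mul_mem_lumpedSpan_of_card (hS : S.Nonempty) (hS1 : S.card ≠ 1)
    (hK : Disjoint K S) (hJ : ∀ a, a ∈ J ↔ a ∈ K ∨ a ∈ S) {f : V0 n → ℂ} (hf : f ∈ coneSpan K) :
    halfSpaceFun J * f ∈ lumpedSpan J := by
  refine mul_mem_of_mem_span ?_ hf
  rintro _ ⟨P, rfl⟩
  change _ * P.coneFun ∈ _
  rw [← P.coneFun_eq_of_snoc hS hK hJ]
  refine coneFun_mem_lumpedSpan _ ?_
  rw [P.snoc_allSinglets_iff]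
  exact fun h => hS1 h.2

/-- Where x_J + x_K ≥ 0, at least one of x_J, x_K is nonnegative, so (1 - H_J)(1 - H_K) = 0.
Elsewhere they are not both nonnegative, and both sides vanish. -/
lemma halfSpaceFun_mul_halfSpaceFun (h : Disjoint J K) (f g : V0 n → ℂ) :
    (halfSpaceFun J * f) * (halfSpaceFun K * g) =
      halfSpaceFun (J ∪ K) * (f * (halfSpaceFun K * g)) +
      halfSpaceFun (J ∪ K) * ((halfSpaceFun J * f) * g) - halfSpaceFun (J ∪ K) * (f * g) := by
  funext x
  simp only [Pi.sub_apply, Pi.add_apply, Pi.mul_apply, halfSpaceFun, Finset.sum_union h]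
  split_ifs <;> first | (exfalso; linarith) | ring1

/-- Induction on the number of labels through the preceding identity: its three terms append the
last block of `P`, the last block of `Q`, and the union of the two. -/
lemma coneFun_mul_coneFun_mem (N : ℕ) : ∀ {J K : Finset (Fin n)} (_ : Disjoint J K)
    (_ : J.card + K.card ≤ N) (P : OrderedSetPartition J) (Q : OrderedSetPartition K),
    P.coneFun * Q.coneFun ∈ coneSpan (J ∪ K) ∧
      (¬ P.AllSinglets ∨ ¬ Q.AllSinglets → P.coneFun * Q.coneFun ∈ lumpedSpan (J ∪ K)) := by
  induction N with
  | zero =>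
    intro J K _ hN P Q
    obtain rfl : J = ∅ := by rw [← Finset.card_eq_zero]; omega
    obtain rfl : K = ∅ := by rw [← Finset.card_eq_zero]; omega
    refine ⟨?_, fun h => ?_⟩
    · rw [P.coneFun_empty, Q.coneFun_empty, mul_one]
      exact one_mem_coneSpan_empty
    · exact (h.elim (fun h => h P.allSinglets_empty) fun h => h Q.allSinglets_empty).elim
  | succ N ih =>
    intro J K hJK hN P Q
    rcases J.eq_empty_or_nonempty with rfl | hJ
    · rw [P.coneFun_empty, one_mul, Finset.empty_union]
      exact ⟨coneFun_mem_coneSpan Q, fun h => coneFun_mem_lumpedSpan Q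
        (h.resolve_left (not_not.2 P.allSinglets_empty))⟩
    rcases K.eq_empty_or_nonempty with rfl | hK
    · rw [Q.coneFun_empty, mul_one, Finset.union_empty]
      exact ⟨coneFun_mem_coneSpan P, fun h => coneFun_mem_lumpedSpan P
        (h.resolve_right (not_not.2 Q.allSinglets_empty))⟩
    obtain ⟨J', S, P', hS, hJ', hJS, hP⟩ := P.exists_eq_snoc hJ
    obtain ⟨K', T, Q', hT, hK', hKT, hQ⟩ := Q.exists_eq_snoc hK
    obtain rfl : J = J' ∪ S := by ext a; simp [hJS a]
    obtain rfl : K = K' ∪ T := by ext a; simp [hKT a]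
    simp only [Finset.disjoint_union_left, Finset.disjoint_union_right] at hJK
    obtain ⟨⟨h1, h2⟩, h3, h4⟩ := hJK
    rw [Finset.card_union_of_disjoint hJ', Finset.card_union_of_disjoint hK'] at hN
    have hS0 := hS.card_pos
    have hT0 := hT.card_pos
    have a1 := ih (J := J') (K := K' ∪ T) (by simp [*])
      (by rw [Finset.card_union_of_disjoint hK']; omega) P' Q
    have a2 := ih (J := J' ∪ S) (K := K') (by simp [*])
      (by rw [Finset.card_union_of_disjoint hJ']; omega) P Q'
    have a3 := ih (J := J') (K := K') (by simp [*]) (by omega) P' Q'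
    -- The correction term loses both last blocks and gains `S ∪ T`, which has at least two labels,
    -- so it is lumped in every case.
    have m3 := halfSpaceFun_mul_mem_lumpedSpan_of_card (S := S ∪ T) (J := J' ∪ S ∪ (K' ∪ T))
      (hS.mono Finset.subset_union_left)
      (by rw [Finset.card_union_of_disjoint h4]; omega)
      (by simp [*, h2.symm]) (by intro a; clear * -; simp only [Finset.mem_union]; tauto) a3.1
    have e := halfSpaceFun_mul_halfSpaceFun (J := J' ∪ S) (K := K' ∪ T) (by simp [*])
      P'.coneFun Q'.coneFun
    rw [← P'.coneFun_eq_of_snoc hS hJ' hJS, ← Q'.coneFun_eq_of_snoc hT hK' hKT, ← hP, ← hQ] at e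
    rw [e]
    have hx1 : Disjoint (J' ∪ (K' ∪ T)) S := by simp [h2.symm, h4.symm, hJ']
    have hx2 : Disjoint (J' ∪ S ∪ K') T := by simp [h3, h4, hK']
    have hy1 : ∀ a, a ∈ J' ∪ S ∪ (K' ∪ T) ↔ a ∈ J' ∪ (K' ∪ T) ∨ a ∈ S := by
      intro a; clear * -; simp only [Finset.mem_union]; tauto
    have hy2 : ∀ a, a ∈ J' ∪ S ∪ (K' ∪ T) ↔ a ∈ J' ∪ S ∪ K' ∨ a ∈ T := by
      intro a; clear * -; simp only [Finset.mem_union]; tauto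
    refine ⟨Submodule.sub_mem _ (Submodule.add_mem _ ?_ ?_) (lumpedSpan_le_coneSpan _ m3),
      fun h => Submodule.sub_mem _ (Submodule.add_mem _ ?_ ?_) m3⟩
    · exact halfSpaceFun_mul_mem_coneSpan hS hx1 hy1 a1.1
    · exact halfSpaceFun_mul_mem_coneSpan hT hx2 hy2 a2.1
    -- A block which is not a singlet either survives in the remaining factors or is the removed
    -- block `S`, which the half space appends again.
    · by_cases hc : ¬ P'.AllSinglets ∨ ¬ Q.AllSinglets
      · exact halfSpaceFun_mul_mem_lumpedSpan hS hx1 hy1 (a1.2 hc)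
      · refine halfSpaceFun_mul_mem_lumpedSpan_of_card hS ?_ hx1 hy1 a1.1
        rw [hP, P'.snoc_allSinglets_iff] at h
        clear * - h hc
        tauto
    · by_cases hc : ¬ P.AllSinglets ∨ ¬ Q'.AllSinglets
      · exact halfSpaceFun_mul_mem_lumpedSpan hT hx2 hy2 (a2.2 hc)
      · refine halfSpaceFun_mul_mem_lumpedSpan_of_card hT ?_ hx2 hy2 a2.1
        rw [hQ, Q'.snoc_allSinglets_iff] at h
        clear * - h hc
        tauto

lemma mul_mem_coneSpan (h : Disjoint J K) {f g : V0 n → ℂ} (hf : f ∈ coneSpan J)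
    (hg : g ∈ coneSpan K) : f * g ∈ coneSpan (J ∪ K) := by
  refine mul_mem_of_mem_span ?_ hg
  rintro _ ⟨Q, rfl⟩
  rw [mul_comm]
  refine mul_mem_of_mem_span ?_ hf
  rintro _ ⟨P, rfl⟩
  rw [mul_comm]
  exact (coneFun_mul_coneFun_mem _ h le_rfl P Q).1

lemma mul_mem_lumpedSpan (h : Disjoint J K) {f g : V0 n → ℂ} (hf : f ∈ lumpedSpan J)
    (hg : g ∈ coneSpan K) : f * g ∈ lumpedSpan (J ∪ K) := by
  refine mul_mem_of_mem_span ?_ hg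
  rintro _ ⟨Q, rfl⟩
  rw [mul_comm]
  refine mul_mem_of_mem_span ?_ hf
  rintro _ ⟨P, hP, rfl⟩
  rw [mul_comm]
  exact (coneFun_mul_coneFun_mem _ h le_rfl P Q).2 (Or.inl hP)

lemma prod_mem_coneSpan {ι : Type*} (s : Finset ι) (K : ι → Finset (Fin n))
    (hK : (s : Set ι).PairwiseDisjoint K) (f : ι → V0 n → ℂ) (hf : ∀ j ∈ s, f j ∈ coneSpan (K j)) :
    ∏ j ∈ s, f j ∈ coneSpan (s.biUnion K) := by
  classical
  induction s using Finset.induction_on with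
  | empty => exact one_mem_coneSpan_empty
  | insert j s hj ih =>
    rw [Finset.prod_insert hj, Finset.biUnion_insert]
    refine mul_mem_coneSpan ?_ (hf j (Finset.mem_insert_self j s))
      (ih (hK.subset (by simp)) fun k hk => hf k (Finset.mem_insert_of_mem hk))
    rw [Finset.disjoint_biUnion_right]
    intro k hk
    exact hK (by simp) (by simp [hk]) (by rintro rfl; exact hj hk)

end Spans

/-! ### Shuffles of words and linear extensions -/

section Words

variable {n : ℕ}

/-- The function of the plate with singlet blocks given by a word, the last block coming first. -/
noncomputable def wordFun : List (Fin n) → V0 n → ℂ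
  | [] => 1
  | a :: v => halfSpaceFun (a :: v).toFinset * wordFun v

/-- The words without repetitions in the letters `K`, in which no letter `a` is to the left of a
letter `b` with `r a b`. -/
noncomputable def extensions (K : Finset (Fin n)) (r : Fin n → Fin n → Prop) :
    Finset (List (Fin n)) :=
  open Classical in K.val.lists.toFinset.filter fun v => v.Pairwise fun a b => ¬ r a b

lemma mem_extensions {K : Finset (Fin n)} {r : Fin n → Fin n → Prop} {v : List (Fin n)} :
    v ∈ extensions K r ↔ v.Nodup ∧ v.toFinset = K ∧ v.Pairwise fun a b => ¬ r a b := by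
  classical
  rw [extensions, Finset.mem_filter, Multiset.mem_toFinset, Multiset.mem_lists_iff,
    Multiset.quot_mk_to_coe, ← and_assoc]
  refine and_congr_left fun _ => ⟨fun h => ?_, fun h => ?_⟩
  · have hv : v.Nodup := by
      rw [← Multiset.coe_nodup, ← h]
      exact K.nodup
    refine ⟨hv, Finset.val_injective ?_⟩
    rw [List.toFinset_val, hv.dedup, h]
  · rw [← h.2, List.toFinset_val, h.1.dedup]

/-- The sum of the functions of all words which extend the relation `r` on `K`. -/
noncomputable def extensionSum (K : Finset (Fin n)) (r : Fin n → Fin n → Prop) : V0 n → ℂ :=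
  ∑ v ∈ extensions K r, wordFun v

/-- The elements of `K` which can come last in an extension of `r`. -/
noncomputable def lastLetters (K : Finset (Fin n)) (r : Fin n → Fin n → Prop) : Finset (Fin n) :=
  open Classical in K.filter fun a => ∀ b ∈ K.erase a, ¬ r a b

lemma mem_lastLetters {K : Finset (Fin n)} {r : Fin n → Fin n → Prop} {a : Fin n} :
    a ∈ lastLetters K r ↔ a ∈ K ∧ ∀ b ∈ K.erase a, ¬ r a b := by
  simp [lastLetters]

lemma extensions_eq_biUnion {K : Finset (Fin n)} (hK : K.Nonempty) (r : Fin n → Fin n → Prop) :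
    extensions K r = (lastLetters K r).biUnion fun a =>
      (extensions (K.erase a) r).image (List.cons a) := by
  ext v
  simp only [Finset.mem_biUnion, Finset.mem_image, mem_extensions, mem_lastLetters]
  constructor
  · rintro ⟨h1, rfl, h3⟩
    obtain _ | ⟨a, v⟩ := v
    · simp at hK
    rw [List.nodup_cons] at h1
    rw [List.pairwise_cons] at h3
    have e : (a :: v).toFinset.erase a = v.toFinset := by
      rw [List.toFinset_cons, Finset.erase_insert (by simpa using h1.1)]
    refine ⟨a, ⟨by simp, ?_⟩, v, ⟨h1.2, e.symm, h3.2⟩, rfl⟩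
    rw [e]
    intro b hb
    exact h3.1 b (by simpa using hb)
  · rintro ⟨a, ⟨ha, h⟩, v, ⟨h1, h2, h3⟩, rfl⟩
    rw [← h2] at h
    have hav : a ∉ v := by
      rw [← List.mem_toFinset, h2]
      simp
    refine ⟨List.nodup_cons.2 ⟨hav, h1⟩, ?_, List.pairwise_cons.2 ⟨fun b hb => h b (by simpa), h3⟩⟩
    rw [List.toFinset_cons, h2, Finset.insert_erase ha]

/-- Extensions are classified by their last letter, which heads the word; the half space of the full
set of letters is common to all of them. -/
lemma extensionSum_eq_mul {K : Finset (Fin n)} (hK : K.Nonempty) (r : Fin n → Fin n → Prop) :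
    extensionSum K r = halfSpaceFun K * ∑ a ∈ lastLetters K r, extensionSum (K.erase a) r := by
  unfold extensionSum
  rw [extensions_eq_biUnion hK, Finset.sum_biUnion, Finset.mul_sum]
  · refine Finset.sum_congr rfl fun a ha => ?_
    rw [Finset.sum_image fun _ _ _ _ h => (List.cons.inj h).2, Finset.mul_sum]
    refine Finset.sum_congr rfl fun v hv => ?_
    rw [wordFun, List.toFinset_cons, (mem_extensions.1 hv).2.1,
      Finset.insert_erase (mem_lastLetters.1 ha).1]
  · intro a _ b _ hab
    rw [Function.onFun, Finset.disjoint_left]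
    intro v hv hv'
    obtain ⟨v, _, rfl⟩ := Finset.mem_image.1 hv
    obtain ⟨v', _, h⟩ := Finset.mem_image.1 hv'
    exact hab (List.cons.inj h).1.symm

lemma extensionSum_empty (r : Fin n → Fin n → Prop) : extensionSum ∅ r = 1 := by
  have : extensions ∅ r = {[]} := by
    ext v
    rw [mem_extensions, List.toFinset_eq_empty_iff, Finset.mem_singleton]
    constructor
    · exact fun h => h.2.1
    · rintro rfl
      simp
  rw [extensionSum, this, Finset.sum_singleton]
  rfl

lemma mem_iff_erase {K : Finset (Fin n)} {a : Fin n} (ha : a ∈ K) (b : Fin n) :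
    b ∈ K ↔ b ∈ K.erase a ∨ b ∈ ({a} : Finset (Fin n)) := by
  by_cases h : b = a <;> simp [h, ha]

lemma extensionSum_mem_coneSpan (r : Fin n → Fin n → Prop) (N : ℕ) :
    ∀ K : Finset (Fin n), K.card = N → extensionSum K r ∈ coneSpan K := by
  induction N with
  | zero =>
    intro K hK
    obtain rfl := Finset.card_eq_zero.1 hK
    rw [extensionSum_empty]
    exact one_mem_coneSpan_empty
  | succ N ih =>
    intro K hK
    rw [extensionSum_eq_mul (Finset.card_pos.1 (by omega)), Finset.mul_sum]
    refine Submodule.sum_mem _ fun a ha => ?_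
    have haK := (mem_lastLetters.1 ha).1
    refine halfSpaceFun_mul_mem_coneSpan (Finset.singleton_nonempty a) (by simp)
      (mem_iff_erase haK) (ih _ ?_)
    rw [Finset.card_erase_of_mem haK, hK, Nat.add_sub_cancel]

lemma lastLetters_union {J K : Finset (Fin n)} {r : Fin n → Fin n → Prop}
    (hr : ∀ a ∈ J, ∀ b ∈ K, ¬ r a b ∧ ¬ r b a) :
    lastLetters (J ∪ K) r = lastLetters J r ∪ lastLetters K r := by
  ext a
  simp only [mem_lastLetters, Finset.mem_union, Finset.mem_erase]
  constructor
  · rintro ⟨h | h, h'⟩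
    · exact Or.inl ⟨h, fun b hb => h' b ⟨hb.1, Or.inl hb.2⟩⟩
    · exact Or.inr ⟨h, fun b hb => h' b ⟨hb.1, Or.inr hb.2⟩⟩
  · rintro (⟨h, h'⟩ | ⟨h, h'⟩)
    · refine ⟨Or.inl h, fun b hb => hb.2.elim (fun hbJ => h' b ⟨hb.1, hbJ⟩) fun hbK => ?_⟩
      exact (hr a h b hbK).1
    · refine ⟨Or.inr h, fun b hb => hb.2.elim (fun hbJ => ?_) fun hbK => h' b ⟨hb.1, hbK⟩⟩
      exact (hr b hbJ a h).2

/-- Shuffle product: modulo lumped plates, the product over two unrelated sets of labels is the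
sum over all extensions of the union. -/
lemma extensionSum_mul_sub_mem (r : Fin n → Fin n → Prop) (N : ℕ) :
    ∀ J K : Finset (Fin n), Disjoint J K → (∀ a ∈ J, ∀ b ∈ K, ¬ r a b ∧ ¬ r b a) →
      J.card + K.card = N →
      extensionSum J r * extensionSum K r - extensionSum (J ∪ K) r ∈ lumpedSpan (J ∪ K) := by
  induction N with
  | zero =>
    intro J K _ _ hN
    obtain rfl : J = ∅ := by rw [← Finset.card_eq_zero]; omega
    rw [extensionSum_empty, one_mul, Finset.empty_union, sub_self]
    exact Submodule.zero_mem _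
  | succ N ih =>
    intro J K hJK hr hN
    rcases J.eq_empty_or_nonempty with rfl | hJ
    · rw [extensionSum_empty, one_mul, Finset.empty_union, sub_self]
      exact Submodule.zero_mem _
    rcases K.eq_empty_or_nonempty with rfl | hK
    · rw [extensionSum_empty, mul_one, Finset.union_empty, sub_self]
      exact Submodule.zero_mem _
    have hJ0 := hJ.card_pos
    have hK0 := hK.card_pos
    have disj : Disjoint (lastLetters J r) (lastLetters K r) :=
      hJK.mono (fun _ h => (mem_lastLetters.1 h).1) (fun _ h => (mem_lastLetters.1 h).1)
    have e := halfSpaceFun_mul_halfSpaceFun hJK (∑ a ∈ lastLetters J r, extensionSum (J.erase a) r)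
      (∑ a ∈ lastLetters K r, extensionSum (K.erase a) r)
    rw [← extensionSum_eq_mul hJ, ← extensionSum_eq_mul hK] at e
    rw [e, extensionSum_eq_mul (hJ.mono Finset.subset_union_left), lastLetters_union hr,
      Finset.sum_union disj]
    have m1 : halfSpaceFun (J ∪ K) * ((∑ a ∈ lastLetters J r, extensionSum (J.erase a) r) *
        extensionSum K r - ∑ a ∈ lastLetters J r, extensionSum ((J ∪ K).erase a) r) ∈
        lumpedSpan (J ∪ K) := by
      rw [Finset.sum_mul, ← Finset.sum_sub_distrib, Finset.mul_sum]
      refine Submodule.sum_mem _ fun a ha => ?_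
      have haJ := (mem_lastLetters.1 ha).1
      have haK := Finset.disjoint_left.1 hJK haJ
      refine halfSpaceFun_mul_mem_lumpedSpan (Finset.singleton_nonempty a) (by simp)
        (mem_iff_erase (Finset.mem_union_left K haJ)) ?_
      rw [Finset.erase_union_distrib, Finset.erase_eq_of_notMem haK]
      refine ih _ _ (hJK.mono_left (Finset.erase_subset a J))
        (fun b hb c hc => hr b (Finset.mem_of_mem_erase hb) c hc) ?_
      rw [Finset.card_erase_of_mem haJ]
      omega
    have m2 : halfSpaceFun (J ∪ K) * (extensionSum J r *
        (∑ a ∈ lastLetters K r, extensionSum (K.erase a) r) -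
        ∑ a ∈ lastLetters K r, extensionSum ((J ∪ K).erase a) r) ∈ lumpedSpan (J ∪ K) := by
      rw [Finset.mul_sum, ← Finset.sum_sub_distrib, Finset.mul_sum]
      refine Submodule.sum_mem _ fun a ha => ?_
      have haK := (mem_lastLetters.1 ha).1
      have haJ := Finset.disjoint_right.1 hJK haK
      refine halfSpaceFun_mul_mem_lumpedSpan (Finset.singleton_nonempty a) (by simp)
        (mem_iff_erase (Finset.mem_union_right J haK)) ?_
      rw [Finset.erase_union_distrib, Finset.erase_eq_of_notMem haJ]
      refine ih _ _ (hJK.mono_right (Finset.erase_subset a K))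
        (fun b hb c hc => hr b hb c (Finset.mem_of_mem_erase hc)) ?_
      rw [Finset.card_erase_of_mem haK]
      omega
    -- This is the merging term of the quasi-shuffle: the two last letters come back as one block
    -- `{a, b}`, so it is lumped.
    have m3 : halfSpaceFun (J ∪ K) * ((∑ a ∈ lastLetters J r, extensionSum (J.erase a) r) *
        ∑ a ∈ lastLetters K r, extensionSum (K.erase a) r) ∈ lumpedSpan (J ∪ K) := by
      rw [Finset.sum_mul_sum, Finset.mul_sum]
      refine Submodule.sum_mem _ fun a ha => ?_
      rw [Finset.mul_sum]
      refine Submodule.sum_mem _ fun b hb => ?_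
      have haJ := (mem_lastLetters.1 ha).1
      have hbK := (mem_lastLetters.1 hb).1
      have haK := Finset.disjoint_left.1 hJK haJ
      have hbJ := Finset.disjoint_right.1 hJK hbK
      have hab : a ≠ b := by
        rintro rfl
        exact haK hbK
      refine halfSpaceFun_mul_mem_lumpedSpan_of_card (S := {a, b}) (by simp)
        (by rw [Finset.card_pair hab]; omega) ?_ ?_
        (mul_mem_coneSpan
          (hJK.mono (Finset.erase_subset a J) (Finset.erase_subset b K))
          (extensionSum_mem_coneSpan r _ _ rfl) (extensionSum_mem_coneSpan r _ _ rfl))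
      · simp [hbJ, haK]
      · intro c
        by_cases hca : c = a
        · simp [hca, haJ]
        · by_cases hcb : c = b
          · simp [hcb, hbK]
          · simp [hca, hcb]
    convert Submodule.sub_mem _ (Submodule.add_mem _ m1 m2) m3 using 1
    ring

lemma extensionSum_congr {K : Finset (Fin n)} {r s : Fin n → Fin n → Prop}
    (h : ∀ a ∈ K, ∀ b ∈ K, r a b ↔ s a b) : extensionSum K r = extensionSum K s := by
  unfold extensionSum
  congr 1
  ext v
  simp only [mem_extensions]
  refine and_congr_right fun _ => and_congr_right fun hv => ?_
  refine List.Pairwise.iff_of_mem fun {a b} ha hb => ?_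
  rw [h a (by rwa [← hv, List.mem_toFinset]) b (by rwa [← hv, List.mem_toFinset])]

/-- A chain of singlets is a total order: only its last block can be the last letter, at every stage
of the recursion. -/
lemma OrderedSetPartition.AllSinglets.coneFun_eq (N : ℕ) : ∀ {J : Finset (Fin n)}
    {P : OrderedSetPartition J} (_ : P.AllSinglets) (_ : J.card = N),
    P.coneFun = extensionSum J P.Lt := by
  induction N with
  | zero =>
    intro J P _ hJ
    obtain rfl := Finset.card_eq_zero.1 hJ
    rw [P.coneFun_empty, extensionSum_empty]
  | succ N ih =>
    intro J P hP hN
    have hJ : J.Nonempty := Finset.card_pos.1 (by omega)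
    obtain ⟨K, S, P', hS, hKS, h, rfl⟩ := P.exists_eq_snoc hJ
    obtain ⟨hP', hS1⟩ := (P'.snoc_allSinglets_iff hS hKS h).1 hP
    obtain ⟨a, rfl⟩ := Finset.card_eq_one.1 hS1
    have haK : a ∉ K := by simpa using hKS
    have haJ : a ∈ J := (h a).2 (by simp)
    have hK : J.erase a = K := by
      ext b
      rw [Finset.mem_erase, h b, Finset.mem_singleton]
      constructor
      · rintro ⟨h1, h2⟩
        exact h2.resolve_right h1
      · intro hb
        exact ⟨fun e => haK (e ▸ hb), Or.inl hb⟩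
    have hlast : lastLetters J (P'.snoc {a} hS hKS h).Lt = {a} := by
      ext b
      rw [mem_lastLetters, Finset.mem_singleton]
      simp only [P'.snoc_lt_iff, Finset.mem_singleton]
      constructor
      · rintro ⟨hb, hb'⟩
        by_contra hba
        refine hb' a (Finset.mem_erase.2 ⟨Ne.symm hba, haJ⟩) (Or.inr ⟨?_, rfl⟩)
        exact ((h b).1 hb).resolve_right (by simpa using hba)
      · rintro rfl
        refine ⟨haJ, fun c hc => ?_⟩
        rintro (hlt | ⟨hbK, _⟩)
        · exact haK hlt.mem_left
        · exact haK hbK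
    rw [P'.coneFun_eq_of_snoc, extensionSum_eq_mul hJ, hlast, Finset.sum_singleton, hK,
      ih hP' (by rw [← hK, Finset.card_erase_of_mem haJ]; omega)]
    congr 1
    refine extensionSum_congr fun b hb c hc => ?_
    rw [P'.snoc_lt_iff]
    refine ⟨Or.inl, fun hbc => hbc.resolve_right fun hbc => haK ?_⟩
    rw [← Finset.mem_singleton.1 hbc.2]
    exact hc

/-- Factors are shuffled in one at a time. The error accumulated so far stays lumped after
multiplication by the new factor, by `mul_mem_lumpedSpan`. -/
lemma prod_extensionSum_sub_mem {ι : Type*} (r : Fin n → Fin n → Prop) (s : Finset ι)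
    (K : ι → Finset (Fin n)) (hK : (s : Set ι).PairwiseDisjoint K)
    (hr : ∀ j ∈ s, ∀ k ∈ s, j ≠ k → ∀ a ∈ K j, ∀ b ∈ K k, ¬ r a b) :
    ∏ j ∈ s, extensionSum (K j) r - extensionSum (s.biUnion K) r ∈ lumpedSpan (s.biUnion K) := by
  classical
  induction s using Finset.induction_on with
  | empty =>
    rw [Finset.prod_empty, Finset.biUnion_empty, extensionSum_empty, sub_self]
    exact Submodule.zero_mem _
  | insert j s hj ih =>
    have ih := ih (hK.subset (by simp)) fun a ha b hb =>
      hr a (Finset.mem_insert_of_mem ha) b (Finset.mem_insert_of_mem hb)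
    rw [Finset.prod_insert hj, Finset.biUnion_insert]
    have hne : ∀ k ∈ s, j ≠ k := by
      rintro k hk rfl
      exact hj hk
    have hd : Disjoint (K j) (s.biUnion K) := by
      rw [Finset.disjoint_biUnion_right]
      intro k hk
      exact hK (by simp) (by simp [hk]) (hne k hk)
    have m1 := mul_mem_lumpedSpan hd.symm ih (extensionSum_mem_coneSpan r _ (K j) rfl)
    rw [Finset.union_comm] at m1
    have m2 := extensionSum_mul_sub_mem r _ (K j) (s.biUnion K) hd (fun a ha b hb => by
      obtain ⟨k, hk, hb⟩ := Finset.mem_biUnion.1 hb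
      have hk' := Finset.mem_insert_of_mem (b := j) hk
      have hj' := Finset.mem_insert_self j s
      exact ⟨hr j hj' k hk' (hne k hk) a ha b hb, hr k hk' j hj' (hne k hk).symm b hb a ha⟩) rfl
    convert Submodule.add_mem _ m1 m2 using 1
    ring

end Words

/-! ### Linear extensions on all labels as permutations -/

section Permutations

variable {n : ℕ}

lemma ofPerm_allSinglets (w : Equiv.Perm (Fin n)) : (OrderedSetPartition.ofPerm w).AllSinglets :=
  fun _ => Finset.card_singleton _

lemma ofPerm_lt_iff (w : Equiv.Perm (Fin n)) (a b : Fin n) :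
    (OrderedSetPartition.ofPerm w).Lt a b ↔ w.symm a < w.symm b := by
  unfold OrderedSetPartition.Lt
  change (∃ q r : Fin n, q < r ∧ a ∈ ({w q} : Finset (Fin n)) ∧ b ∈ ({w r} : Finset (Fin n))) ↔ _
  constructor
  · rintro ⟨q, r, h, ha, hb⟩
    rw [Finset.mem_singleton] at ha hb
    rwa [ha, hb, w.symm_apply_apply, w.symm_apply_apply]
  · intro h
    exact ⟨_, _, h, by simp, by simp⟩

/-- The letters of a permutation, the last one coming first. -/
def permWord (w : Equiv.Perm (Fin n)) : List (Fin n) :=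
  (List.ofFn w).reverse

lemma permWord_mem_extensions (w : Equiv.Perm (Fin n)) (r : Fin n → Fin n → Prop) :
    permWord w ∈ extensions Finset.univ r ↔ ∀ a b, w.symm b < w.symm a → ¬ r a b := by
  rw [mem_extensions, permWord, List.nodup_reverse, List.nodup_ofFn, List.pairwise_reverse,
    List.pairwise_ofFn]
  constructor
  · rintro ⟨-, -, h⟩ a b hab
    simpa using h hab
  · intro h
    refine ⟨w.injective, ?_, fun q q' hq => h _ _ (by simpa using hq)⟩
    ext a
    simp only [List.toFinset_reverse, List.mem_toFinset, List.mem_ofFn, Finset.mem_univ, iff_true]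
    exact w.surjective a

lemma permWord_injective : Function.Injective (permWord (n := n)) := by
  intro w w' h
  have := List.ofFn_injective (List.reverse_injective h)
  exact Equiv.coe_fn_injective this

lemma exists_permWord_eq {v : List (Fin n)} (hv : v.Nodup) (hu : v.toFinset = Finset.univ) :
    ∃ w, permWord w = v := by
  have hlen : v.reverse.length = n := by
    rw [List.length_reverse, ← List.toFinset_card_of_nodup hv, hu, Finset.card_fin]
  have hmem : ∀ a, a ∈ v.reverse := by
    intro a
    rw [List.mem_reverse, ← List.mem_toFinset, hu]
    exact Finset.mem_univ a
  let e := List.Nodup.getEquivOfForallMemList v.reverse (List.nodup_reverse.2 hv) hmem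
  refine ⟨(finCongr hlen.symm).trans e, ?_⟩
  rw [permWord, List.reverse_eq_iff]
  refine List.ext_get (by simp [hlen]) fun k h1 h2 => ?_
  simp [e, List.Nodup.getEquivOfForallMemList]

lemma wordFun_permWord (w : Equiv.Perm (Fin n)) :
    wordFun (permWord w) = (OrderedSetPartition.ofPerm w).coneFun := by
  rw [(ofPerm_allSinglets w).coneFun_eq _ rfl, extensionSum]
  have hw : permWord w ∈ extensions Finset.univ (OrderedSetPartition.ofPerm w).Lt := by
    rw [permWord_mem_extensions]
    intro a b h
    rw [ofPerm_lt_iff]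
    exact h.asymm
  have : extensions Finset.univ (OrderedSetPartition.ofPerm w).Lt = {permWord w} := by
    refine Finset.eq_singleton_iff_unique_mem.2 ⟨hw, fun v hv => ?_⟩
    rw [mem_extensions] at hw hv
    -- Distinct letters are comparable in a chain. This is the antisymmetry that leaves only one
    -- sorted arrangement of the letters.
    refine List.Perm.eq_of_pairwise (fun a b _ _ hab hba => ?_) hv.2.2 hw.2.2
      (List.perm_of_nodup_nodup_toFinset_eq hv.1 hw.1 (hv.2.1.trans hw.2.1.symm))
    by_contra hne
    exact ((ofPerm_allSinglets w).lt_or_lt (Finset.mem_univ a) (Finset.mem_univ b) hne).elim hab hba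
  rw [this, Finset.sum_singleton]

open Classical in
lemma extensionSum_univ (r : Fin n → Fin n → Prop) :
    extensionSum Finset.univ r = ∑ w : Equiv.Perm (Fin n) with
      (∀ a b, w.symm b < w.symm a → ¬ r a b), (OrderedSetPartition.ofPerm w).coneFun := by
  have : extensions Finset.univ r = (Finset.univ.filter fun w : Equiv.Perm (Fin n) =>
      ∀ a b, w.symm b < w.symm a → ¬ r a b).image permWord := by
    ext v
    simp only [Finset.mem_image, Finset.mem_filter, Finset.mem_univ, true_and]
    constructor
    · intro hv
      obtain ⟨w, rfl⟩ := exists_permWord_eq (mem_extensions.1 hv).1 (mem_extensions.1 hv).2.1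
      exact ⟨w, (permWord_mem_extensions w r).1 hv, rfl⟩
    · rintro ⟨w, hw, rfl⟩
      exact (permWord_mem_extensions w r).2 hw
  rw [extensionSum, this, Finset.sum_image fun _ _ _ _ h => permWord_injective h]
  exact Finset.sum_congr rfl fun w _ => wordFun_permWord w

end Permutations

/-! ### Plates, Minkowski sums and convolution products -/

section Plates

variable {n : ℕ}

lemma V0.sum_eq_zero (x : V0 n) : ∑ a, (x : EuclideanSpace ℝ (Fin n)) a = 0 := x.2

namespace OrderedSetPartition

variable {J : Finset (Fin n)}

lemma prefixSum_last (P : OrderedSetPartition J) {q : Fin P.len} (hq : (q : ℕ) + 1 = P.len)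
    (x : V0 n) : P.prefixSum q x = ∑ a ∈ J, (x : EuclideanSpace ℝ (Fin n)) a := by
  rw [← sum_block P, prefixSum]
  congr 1
  ext r
  simp only [Finset.mem_Iic, Finset.mem_univ, iff_true, Fin.le_def]
  omega

lemma len_pos (P : OrderedSetPartition J) (hJ : J.Nonempty) : 0 < P.len := by
  obtain ⟨a, ha⟩ := hJ
  obtain ⟨q, _⟩ := (P.union a).1 ha
  exact q.pos

/-- The extra condition on the last prefix sum is harmless: once the coordinates off `J` vanish,
that sum is the total, which is zero. -/
lemma mem_plate_iff (P : OrderedSetPartition J) {x : V0 n} :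
    x ∈ P.plate ↔ (∀ a, a ∉ J → (x : EuclideanSpace ℝ (Fin n)) a = 0) ∧
      ∀ q, 0 ≤ P.prefixSum q x := by
  refine and_congr_right fun h0 => ⟨fun h q => ?_, fun h q _ => h q⟩
  by_cases hq : (q : ℕ) + 1 < P.len
  · exact h q hq
  · rw [P.prefixSum_last (by omega), Finset.sum_subset (Finset.subset_univ J) fun a _ ha => h0 a ha,
      V0.sum_eq_zero]

lemma charFn_plate (P : OrderedSetPartition (Finset.univ : Finset (Fin n))) :
    charFn P.plate = P.coneFun := by
  classical
  funext x
  simp [charFn, coneFun, Set.indicator_apply, P.mem_plate_iff]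

lemma prefixSum_congr (P : OrderedSetPartition J) {x y : V0 n}
    (h : ∀ a ∈ J, (x : EuclideanSpace ℝ (Fin n)) a = (y : EuclideanSpace ℝ (Fin n)) a)
    (q : Fin P.len) : P.prefixSum q x = P.prefixSum q y :=
  Finset.sum_congr rfl fun r _ => Finset.sum_congr rfl fun a ha => h a ((P.union a).2 ⟨r, ha⟩)

/-- A plate with a block which is not a singlet contains a line. -/
lemma not_isPointed {P : OrderedSetPartition J} (h : ¬ P.AllSinglets) : ¬ IsPointed P.plate := by
  obtain ⟨q, hq⟩ := not_forall.1 h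
  have hpos := (P.nonempty q).card_pos
  obtain ⟨a, ha, b, hb, hab⟩ := Finset.one_lt_card.1 (by omega : 1 < (P.block q).card)
  let v : V0 n := ⟨EuclideanSpace.single a 1 - EuclideanSpace.single b 1, by
    change ∑ c, (EuclideanSpace.single a (1 : ℝ) - EuclideanSpace.single b (1 : ℝ)) c = 0
    simp⟩
  have hv : ∀ c, (v : EuclideanSpace ℝ (Fin n)) c = (if c = a then 1 else 0) - if c = b then 1 else 0 := by
    intro c
    simp [v]
  intro hP
  -- The line through the origin in the direction e_a - e_b, with `a` and `b` in one block, stays in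
  -- the plate: all block sums vanish on it.
  obtain ⟨t, ht⟩ := hP 0 v fun h0 => by
    have := hv a
    rw [h0] at this
    simp [hab] at this
  refine ht (P.mem_plate_iff.2 ⟨fun c hc => ?_, fun r => ?_⟩)
  · have h1 : c ≠ a := by
      rintro rfl
      exact hc ((P.union c).2 ⟨q, ha⟩)
    have h2 : c ≠ b := by
      rintro rfl
      exact hc ((P.union c).2 ⟨q, hb⟩)
    rw [zero_add]
    change t * (v : EuclideanSpace ℝ (Fin n)) c = 0
    rw [hv, if_neg h1, if_neg h2, sub_self, mul_zero]
  · refine (Finset.sum_eq_zero fun s _ => ?_).ge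
    rw [zero_add]
    change ∑ c ∈ P.block s, t * (v : EuclideanSpace ℝ (Fin n)) c = 0
    rw [← Finset.mul_sum, Finset.sum_congr rfl fun c _ => hv c, Finset.sum_sub_distrib,
      Finset.sum_ite_eq', Finset.sum_ite_eq']
    by_cases hs : s = q
    · subst hs
      rw [if_pos ha, if_pos hb, sub_self, mul_zero]
    · rw [if_neg fun h => hs (P.eq_of_mem_block h ha), if_neg fun h => hs (P.eq_of_mem_block h hb),
        sub_self, mul_zero]

end OrderedSetPartition

lemma coneSpan_univ : coneSpan (Finset.univ : Finset (Fin n)) = PHat n := by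
  rw [coneSpan, PHat]
  congr 2
  funext P
  exact P.charFn_plate.symm

/-- Only one inclusion is needed, that lumped plates are not pointed; whether plates of singlets are
pointed plays no role. -/
lemma mem_nonPointedSpan {f : PHat n}
    (hf : (f : V0 n → ℂ) ∈ lumpedSpan (Finset.univ : Finset (Fin n))) : f ∈ nonPointedSpan n := by
  have h : lumpedSpan (Finset.univ : Finset (Fin n)) ≤ (nonPointedSpan n).map (PHat n).subtype := by
    refine Submodule.span_le.2 ?_
    rintro _ ⟨P, hP, rfl⟩
    exact ⟨plateFun P, Submodule.subset_span ⟨P, OrderedSetPartition.not_isPointed hP, rfl⟩,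
      P.charFn_plate⟩
  obtain ⟨g, hg, hgf⟩ := h hf
  obtain rfl : g = f := Subtype.ext hgf
  exact hg

namespace CompositeSetPartition

variable (T : CompositeSetPartition n)

lemma part_unique {J K : Finset (Fin n)} (hJ : J ∈ T.support.parts) (hK : K ∈ T.support.parts)
    {a : Fin n} (haJ : a ∈ J) (haK : a ∈ K) : J = K :=
  T.support.eq_of_mem_parts hJ hK haJ haK

lemma exists_part (a : Fin n) : ∃ J ∈ T.support.parts, a ∈ J := by
  have h : a ∈ T.support.parts.biUnion id := by
    rw [T.support.biUnion_parts]
    exact Finset.mem_univ a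
  simpa using h

lemma pairwiseDisjoint_parts :
    ((Finset.univ : Finset T.support.parts) : Set T.support.parts).PairwiseDisjoint
      fun J => (J : Finset (Fin n)) := by
  intro J _ K _ hJK
  rw [Function.onFun, Finset.disjoint_left]
  intro a ha hb
  exact hJK (Subtype.ext (T.part_unique J.2 K.2 ha hb))

lemma biUnion_univ_parts :
    (Finset.univ : Finset T.support.parts).biUnion (fun J => (J : Finset (Fin n))) =
      Finset.univ := by
  ext a
  obtain ⟨J, hJ, ha⟩ := T.exists_part a
  simp only [Finset.mem_biUnion, Finset.mem_univ, true_and, iff_true]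
  exact ⟨⟨J, hJ⟩, ha⟩

/-- There is a vector with the coordinates in `J` equal to those of `x`, and all others zero. -/
lemma exists_restriction {J : Finset (Fin n)} {x : V0 n}
    (hx : ∑ a ∈ J, (x : EuclideanSpace ℝ (Fin n)) a = 0) :
    ∃ y : V0 n, ∀ a, (y : EuclideanSpace ℝ (Fin n)) a =
      if a ∈ J then (x : EuclideanSpace ℝ (Fin n)) a else 0 := by
  refine ⟨⟨WithLp.toLp 2 fun a => if a ∈ J then (x : EuclideanSpace ℝ (Fin n)) a else 0, ?_⟩,
    fun a => rfl⟩
  change ∑ a, (if a ∈ J then (x : EuclideanSpace ℝ (Fin n)) a else 0) = 0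
  rw [Finset.sum_ite_mem, Finset.univ_inter, hx]

lemma sum_coe_apply {ι : Type*} (s : Finset ι) (g : ι → V0 n) (a : Fin n) :
    ((∑ j ∈ s, g j : V0 n) : EuclideanSpace ℝ (Fin n)) a =
      ∑ j ∈ s, (g j : EuclideanSpace ℝ (Fin n)) a := by
  simp

/-- The summand belonging to a part must be the restriction of `x` to it. The restriction lies in
`V0 n` because the part sums are nonnegative with total zero, so each of them vanishes. -/
lemma mem_sum_plate_iff {x : V0 n} :
    x ∈ ∑ J, (T.part J).plate ↔ ∀ J q, 0 ≤ (T.part J).prefixSum q x := by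
  classical
  rw [Set.mem_fintype_sum]
  constructor
  · rintro ⟨g, hg, rfl⟩ J q
    rw [(T.part J).prefixSum_congr (y := g J)]
    · exact ((T.part J).mem_plate_iff.1 (hg J)).2 q
    · intro a ha
      rw [sum_coe_apply, Finset.sum_eq_single J]
      · intro K _ hK
        refine ((T.part K).mem_plate_iff.1 (hg K)).1 a fun haK => hK ?_
        exact Subtype.ext (T.part_unique K.2 J.2 haK ha)
      · exact fun h => absurd (Finset.mem_univ J) h
  · intro h
    have hnn : ∀ J : T.support.parts,
        0 ≤ ∑ a ∈ (J : Finset (Fin n)), (x : EuclideanSpace ℝ (Fin n)) a := by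
      intro J
      have hpos := (T.part J).len_pos (T.support.nonempty_of_mem_parts J.2)
      rw [← (T.part J).prefixSum_last (q := ⟨(T.part J).len - 1, by omega⟩)
        (by simp only; omega)]
      exact h J _
    have hsum : ∑ J : T.support.parts,
        ∑ a ∈ (J : Finset (Fin n)), (x : EuclideanSpace ℝ (Fin n)) a = 0 := by
      rw [← Finset.sum_biUnion T.pairwiseDisjoint_parts, T.biUnion_univ_parts, V0.sum_eq_zero]
    have hzero := fun J => (Finset.sum_eq_zero_iff_of_nonneg fun J _ => hnn J).1 hsum J
      (Finset.mem_univ J)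
    choose g hg using fun J => exists_restriction (hzero J)
    refine ⟨g, fun J => (T.part J).mem_plate_iff.2 ⟨fun a ha => ?_, fun q => ?_⟩, ?_⟩
    · rw [hg, if_neg ha]
    · rw [(T.part J).prefixSum_congr (y := x)]
      · exact h J q
      · intro a ha
        rw [hg, if_pos ha]
    · ext a
      obtain ⟨J, hJ, ha⟩ := T.exists_part a
      rw [sum_coe_apply, Finset.sum_eq_single ⟨J, hJ⟩, hg, if_pos ha]
      · intro K _ hK
        rw [hg, if_neg]
        exact fun haK => hK (Subtype.ext (T.part_unique K.2 hJ haK ha))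
      · exact fun h => absurd (Finset.mem_univ _) h

lemma convolution_eq_prod : convolution T = ∏ J, (T.part J).coneFun := by
  classical
  funext x
  rw [convolution, charFn, Set.indicator_apply, Finset.prod_apply]
  simp only [T.mem_sum_plate_iff, OrderedSetPartition.coneFun]
  rw [Finset.prod_ite_zero]
  simp

lemma convolution_mem : convolution T ∈ PHat n := by
  have h := prod_mem_coneSpan _ _ T.pairwiseDisjoint_parts _ fun J _ =>
    coneFun_mem_coneSpan (T.part J)
  rwa [T.biUnion_univ_parts, ← T.convolution_eq_prod, coneSpan_univ] at h

lemma lt_iff_of_mem (J : T.support.parts) {a b : Fin n} (h : a ∈ (J : Finset (Fin n))) :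
    T.Lt a b ↔ (T.part J).Lt a b := by
  refine ⟨?_, fun h => ⟨J, h⟩⟩
  rintro ⟨K, hK⟩
  obtain rfl : J = K := Subtype.ext (T.part_unique J.2 K.2 h hK.mem_left)
  exact hK

variable {T} in
lemma Lt.samePart {a b : Fin n} (h : T.Lt a b) : T.SamePart a b := by
  obtain ⟨J, hJ⟩ := h
  exact ⟨J, J.2, hJ.mem_left, hJ.mem_right⟩

/-- Compatibility of a permutation `w` with a composite set partition: `p_a < p_b` implies that
`a` is to the left of `b` in `(w₁, …, wₙ)`. -/
def Compatible (w : Equiv.Perm (Fin n)) : Prop :=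
  ∀ a b, w.symm b < w.symm a → ¬ T.Lt a b

open Classical in
/-- Modulo lumped plates, the convolution product is the sum over all linear extensions. -/
lemma convolution_sub_mem (hT : T.AllSinglets) :
    convolution T - ∑ w : Equiv.Perm (Fin n) with T.Compatible w,
      (OrderedSetPartition.ofPerm w).coneFun ∈ lumpedSpan Finset.univ := by
  have h := prod_extensionSum_sub_mem T.Lt Finset.univ _ T.pairwiseDisjoint_parts
    (fun J _ K _ hJK a ha b hb hab => hJK (by
      obtain ⟨M, hM, haM, hbM⟩ := hab.samePart
      exact Subtype.ext ((T.part_unique J.2 hM ha haM).trans (T.part_unique hM K.2 hbM hb))))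
  rw [T.biUnion_univ_parts, extensionSum_univ] at h
  have e : convolution T = ∏ J : T.support.parts, extensionSum (J : Finset (Fin n)) T.Lt := by
    rw [T.convolution_eq_prod]
    refine Finset.prod_congr rfl fun J _ => ?_
    rw [(hT J).coneFun_eq _ rfl]
    exact extensionSum_congr fun a ha b _ => (T.lt_iff_of_mem J ha).symm
  rw [e]
  convert h using 2
  exact Finset.sum_congr (Finset.filter_congr fun _ _ => Iff.rfl) fun _ _ => rfl

/-- A convolution product with at least two factors vanishes almost everywhere. -/
lemma convolution_ae_eq_zero (hT : T.size ≠ 1) (hn : 0 < n) :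
    convolution T =ᵐ[MeasureTheory.volume] 0 := by
  obtain ⟨J, hJ, ha⟩ := T.exists_part ⟨0, hn⟩
  have hne : ∃ b, b ∉ J := by
    by_contra! hall
    refine hT (Finset.card_eq_one.2 ⟨J, Finset.eq_singleton_iff_unique_mem.2 ⟨hJ, fun K hK => ?_⟩⟩)
    obtain ⟨b, hb⟩ := T.support.nonempty_of_mem_parts hK
    exact T.part_unique hK hJ hb (hall b)
  obtain ⟨b, hb⟩ := hne
  have hab : (⟨0, hn⟩ : Fin n) ≠ b := by
    rintro rfl
    exact hb ha
  generalize (⟨0, hn⟩ : Fin n) = a at ha hab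
  -- Every plate lies in `V0 n` and is supported on its own part, so the coordinate sum over the
  -- proper part `J` vanishes on the whole Minkowski sum.
  let φ : V0 n →ₗ[ℝ] ℝ :=
    { toFun := fun x => ∑ a ∈ J, (x : EuclideanSpace ℝ (Fin n)) a
      map_add' := fun x y => by simp [Finset.sum_add_distrib]
      map_smul' := fun c x => by simp [Finset.mul_sum] }
  have hφ : LinearMap.ker φ ≠ ⊤ := by
    intro h
    let v : V0 n := ⟨EuclideanSpace.single a 1 - EuclideanSpace.single b 1, by
      change ∑ c, (EuclideanSpace.single a (1 : ℝ) - EuclideanSpace.single b (1 : ℝ)) c = 0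
      simp⟩
    have hv : φ v = 0 := by
      rw [← LinearMap.mem_ker, h]
      trivial
    have : φ v = 1 := by
      change ∑ c ∈ J, (EuclideanSpace.single a (1 : ℝ) - EuclideanSpace.single b (1 : ℝ)) c = 1
      simp [Finset.sum_sub_distrib, ha, hb]
    linarith
  have hnull := MeasureTheory.Measure.addHaar_submodule
    (MeasureTheory.volume : MeasureTheory.Measure (V0 n)) _ hφ
  refine MeasureTheory.measure_mono_null (fun x hx => ?_) hnull
  by_contra hxφ
  have hmem : x ∈ ∑ J, (T.part J).plate := by
    by_contra hmem
    refine hx ?_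
    rw [Set.mem_ofPred_eq]
    exact Set.indicator_of_notMem hmem (fun _ => (1 : ℂ))
  refine hxφ ?_
  obtain ⟨g, hg, rfl⟩ := (Set.mem_fintype_sum _ _).1 hmem
  change φ _ = 0
  rw [map_sum]
  refine Finset.sum_eq_zero fun K _ => ?_
  have h0 := ((T.part K).mem_plate_iff.1 (hg K)).1
  change ∑ a ∈ J, (g K : EuclideanSpace ℝ (Fin n)) a = 0
  by_cases hKJ : (K : Finset (Fin n)) = J
  · rw [← V0.sum_eq_zero (g K)]
    exact Finset.sum_subset (Finset.subset_univ J) fun c _ hc => h0 c (hKJ ▸ hc)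
  · exact Finset.sum_eq_zero fun c hc => h0 c fun hcK => hKJ (T.part_unique K.2 hJ hcK hc)

end CompositeSetPartition

end Plates

/-! ### Ordering a part by a permutation -/

section Restriction

variable {n : ℕ}

/-- The ordered set partition of `J` into singlets, ordered as in `(w₁, …, wₙ)`. -/
noncomputable def restrictPerm (w : Equiv.Perm (Fin n)) (J : Finset (Fin n)) :
    OrderedSetPartition J where
  len := (J.map w.symm.toEmbedding).card
  block q := {w ((J.map w.symm.toEmbedding).orderEmbOfFin rfl q)}
  nonempty q := Finset.singleton_nonempty _
  disjoint q r h := by simpa using h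
  union a := by
    have h : a ∈ J ↔ w.symm a ∈ Set.range ((J.map w.symm.toEmbedding).orderEmbOfFin rfl) := by
      rw [Finset.range_orderEmbOfFin]
      simp
    rw [h]
    simp only [Set.mem_range, Finset.mem_singleton, Equiv.eq_symm_apply]
    exact ⟨fun ⟨q, hq⟩ => ⟨q, hq.symm⟩, fun ⟨q, hq⟩ => ⟨q, hq.symm⟩⟩

lemma restrictPerm_allSinglets (w : Equiv.Perm (Fin n)) (J : Finset (Fin n)) :
    (restrictPerm w J).AllSinglets :=
  fun _ => Finset.card_singleton _

lemma symm_lt_of_restrictPerm_lt {w : Equiv.Perm (Fin n)} {J : Finset (Fin n)} {a b : Fin n}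
    (h : (restrictPerm w J).Lt a b) : w.symm a < w.symm b := by
  obtain ⟨q, r, hqr, ha, hb⟩ := h
  rw [Finset.mem_singleton.1 ha, Finset.mem_singleton.1 hb, w.symm_apply_apply, w.symm_apply_apply]
  exact (OrderEmbedding.lt_iff_lt _).2 hqr

lemma restrictPerm_lt {w : Equiv.Perm (Fin n)} {J : Finset (Fin n)} {a b : Fin n}
    (ha : a ∈ J) (hb : b ∈ J) (h : w.symm a < w.symm b) : (restrictPerm w J).Lt a b := by
  refine ((restrictPerm_allSinglets w J).lt_or_lt ha hb ?_).resolve_right fun h' =>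
    h.asymm (symm_lt_of_restrictPerm_lt h')
  rintro rfl
  exact lt_irrefl _ h

/-- Both sides list `J` in singlets by increasing position in `w`, and the increasing enumeration of
a finite set is unique. -/
lemma eq_restrictPerm {w : Equiv.Perm (Fin n)} {J : Finset (Fin n)} {P : OrderedSetPartition J}
    (hP : P.AllSinglets) (h : ∀ a b, P.Lt a b → w.symm a < w.symm b) : P = restrictPerm w J := by
  have hlen : P.len = (J.map w.symm.toEmbedding).card := by
    have := P.sum_block fun _ => 1
    simp only [Finset.sum_const, hP _, one_smul, Finset.card_univ, Fintype.card_fin, nsmul_eq_mul,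
      mul_one] at this
    rw [Finset.card_map]
    exact_mod_cast this
  choose p hp using fun q => Finset.card_eq_one.1 (hP q)
  have hmono : StrictMono fun q => w.symm (p q) := fun q r hqr =>
    h _ _ ⟨q, r, hqr, by simp [hp], by simp [hp]⟩
  have hmem : ∀ q, w.symm (p q) ∈ J.map w.symm.toEmbedding := fun q => by
    have : p q ∈ J := (P.union _).2 ⟨q, by simp [hp]⟩
    simpa using this
  obtain ⟨len, block, _, _, _⟩ := P
  dsimp only at hlen p hp hmono hmem
  subst hlen
  have key := Finset.orderEmbOfFin_unique rfl hmem hmono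
  unfold restrictPerm
  congr 1
  funext q
  rw [hp, ← key, w.apply_symm_apply]

end Restriction

/-! ### Cutting (i_1, …, i_l) into runs, and the coefficient of a permutation -/

section Cuts

variable {n : ℕ}

lemma Finpartition.ext_part {s : Finset (Fin n)} {P Q : Finpartition s}
    (h : ∀ a ∈ s, ∀ b ∈ s, P.part a = P.part b ↔ Q.part a = Q.part b) : P = Q := by
  have key : ∀ P : Finpartition s, P.parts = s.image P.part := by
    intro P
    ext t
    rw [Finset.mem_image]
    constructor
    · exact fun ht => P.part_surjOn ht
    · rintro ⟨a, ha, rfl⟩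
      exact P.part_mem.2 ha
  have hpart : ∀ a ∈ s, P.part a = Q.part a := by
    intro a ha
    ext b
    by_cases hb : b ∈ s
    · rw [P.mem_part_iff_part_eq_part hb ha, Q.mem_part_iff_part_eq_part hb ha, h b hb a ha]
    · exact iff_of_false (fun h => hb (P.part_subset a h)) (fun h => hb (Q.part_subset a h))
  refine Finpartition.ext ?_
  rw [key P, key Q]
  exact Finset.image_congr hpart

/-- The position of the label which represents the position `p`: all positions from `l` on are
represented by the first one. -/
def representative (l : ℕ) (p : Fin n) : Fin n :=
  if (p : ℕ) < l then p else ⟨0, p.pos⟩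

/-- The cuts to the right of position `p` if the positions `b ∈ E` are joined to `b - 1`. -/
def cutsAbove (l : ℕ) (E : Finset (Fin n)) (p : Fin n) : Finset (Fin n) :=
  Finset.univ.filter fun b => (b : ℕ) < l ∧ b ∉ E ∧ representative l p < b

lemma cutsAbove_representative (l : ℕ) (E : Finset (Fin n)) (p : Fin n) :
    cutsAbove l E (representative l p) = cutsAbove l E p := by
  have : representative l (representative l p) = representative l p := by
    unfold representative
    split_ifs <;> rfl
  unfold cutsAbove
  rw [this]

/-- The set of cuts to the right shrinks as the position moves right. What is lost from `p` to `q`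
is the set of positions in (p, q] outside `E`. -/
lemma cutsAbove_eq_iff {l : ℕ} {E : Finset (Fin n)} {p q : Fin n} (hpq : p < q)
    (hq : (q : ℕ) < l) :
    cutsAbove l E p = cutsAbove l E q ↔ ∀ b, p < b → b ≤ q → b ∈ E := by
  have hp : (p : ℕ) < l := lt_trans hpq hq
  constructor
  · intro h b hpb hbq
    by_contra hb
    have : b ∈ cutsAbove l E q := by
      rw [← h]
      simp only [cutsAbove, Finset.mem_filter, Finset.mem_univ, true_and, representative, if_pos hp]
      exact ⟨lt_of_le_of_lt hbq hq, hb, hpb⟩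
    simp only [cutsAbove, Finset.mem_filter, Finset.mem_univ, true_and, representative,
      if_pos hq] at this
    exact not_lt_of_ge hbq this.2.2
  · intro h
    ext b
    simp only [cutsAbove, Finset.mem_filter, Finset.mem_univ, true_and, representative, if_pos hp,
      if_pos hq]
    refine and_congr_right fun _ => and_congr_right fun hb => ⟨fun hpb => ?_, hpq.trans⟩
    by_contra hqb
    exact hb (h b hpb (not_lt.1 hqb))

/-- The positions `b < l` such that the labels at `b - 1` and `b` satisfy the relation `r`. -/
noncomputable def joints (l : ℕ) (r : Fin n → Fin n → Prop) : Finset (Fin n) :=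
  open Classical in
  Finset.univ.filter fun b => (b : ℕ) < l ∧ ∃ g : Fin n, (b : ℕ) = g + 1 ∧ r g b

lemma mem_joints {l : ℕ} {r : Fin n → Fin n → Prop} {b : Fin n} :
    b ∈ joints l r ↔ (b : ℕ) < l ∧ ∃ g : Fin n, (b : ℕ) = g + 1 ∧ r g b := by
  simp [joints]

namespace CompositeSetPartition

lemma samePart_iff (T : CompositeSetPartition n) (a b : Fin n) :
    T.SamePart a b ↔ T.support.part a = T.support.part b := by
  rw [← T.support.mem_part_iff_part_eq_part (Finset.mem_univ a) (Finset.mem_univ b),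
    T.support.mem_part_iff_exists]
  rfl

variable {T : CompositeSetPartition n} {i : Equiv.Perm (Fin n)} {l : ℕ}

lemma SamePart.symm {a b : Fin n} (h : T.SamePart a b) : T.SamePart b a := by
  rw [samePart_iff] at *
  exact h.symm

lemma SamePart.trans {a b c : Fin n} (h : T.SamePart a b) (h' : T.SamePart b c) :
    T.SamePart a c := by
  rw [samePart_iff] at *
  exact h.trans h'

lemma SamePart.refl (T : CompositeSetPartition n) (a : Fin n) : T.SamePart a a := by
  rw [samePart_iff]

/-- The positions whose labels are in the same part as the labels just before. -/
noncomputable def joined (T : CompositeSetPartition n) (i : Equiv.Perm (Fin n)) (l : ℕ) :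
    Finset (Fin n) :=
  joints l fun g b => T.SamePart (i g) (i b)

lemma Oriented.samePart_between (hT : T.Oriented i l) {p q c : Fin n} (hpc : p ≤ c) (hcq : c ≤ q)
    (hq : (q : ℕ) < l) (h : T.SamePart (i p) (i q)) : T.SamePart (i p) (i c) := by
  rcases hpc.eq_or_lt with rfl | hpc
  · exact SamePart.refl T _
  rcases hcq.eq_or_lt with rfl | hcq
  · exact h
  exact (hT.1 p q (hpc.trans hcq) hq h).2 c hpc hcq

lemma Oriented.samePart_iff_forall (hT : T.Oriented i l) {p q : Fin n} (hpq : p < q)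
    (hq : (q : ℕ) < l) :
    T.SamePart (i p) (i q) ↔ ∀ b, p < b → b ≤ q → b ∈ T.joined i l := by
  constructor
  · intro h b hpb hbq
    rw [Fin.lt_def] at hpb
    have hb := b.2
    refine mem_joints.2 ⟨lt_of_le_of_lt hbq hq, ⟨b - 1, by omega⟩, by simp only; omega, ?_⟩
    refine SamePart.trans (SamePart.symm (hT.samePart_between ?_ ?_ hq h))
      (hT.samePart_between hpb.le hbq hq h)
    · rw [Fin.le_def]
      simp only
      omega
    · rw [Fin.le_def] at *
      simp only
      omega
  · intro h
    have key : ∀ k, ∀ c : Fin n, (c : ℕ) = p + k → c ≤ q → T.SamePart (i p) (i c) := by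
      intro k
      induction k with
      | zero =>
        intro c hc _
        obtain rfl : c = p := Fin.ext hc
        exact SamePart.refl T _
      | succ k ih =>
        intro c hc hcq
        obtain ⟨-, g, hg, hgc⟩ := mem_joints.1 (h c (by rw [Fin.lt_def]; omega) hcq)
        exact (ih g (by omega) (by rw [Fin.le_def] at *; omega)).trans hgc
    exact key (q - p) q (by rw [Fin.lt_def] at hpq; omega) le_rfl

lemma Oriented.samePart_representative (hT : T.Oriented i l) (hl : 1 ≤ l) (p : Fin n) :
    T.SamePart (i (representative l p)) (i p) := by
  unfold representative
  split_ifs with h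
  · exact SamePart.refl T _
  · refine (hT.2 _ p ?_ (Or.inl rfl) (not_lt.1 h)).samePart
    rw [Fin.lt_def]
    simp only
    omega

/-- The joints thus determine the support. Positions from `l` on share the part of position `0`, so
passing to representatives reduces to positions below `l`, where sharing a part means that no cut
lies between. -/
lemma Oriented.samePart_iff_cutsAbove (hT : T.Oriented i l) (hl : 1 ≤ l) (p q : Fin n) :
    T.SamePart (i p) (i q) ↔ cutsAbove l (T.joined i l) p = cutsAbove l (T.joined i l) q := by
  have key : ∀ p q : Fin n, p < q → (q : ℕ) < l → (T.SamePart (i p) (i q) ↔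
      cutsAbove l (T.joined i l) p = cutsAbove l (T.joined i l) q) := fun p q hpq hq => by
    rw [hT.samePart_iff_forall hpq hq, cutsAbove_eq_iff hpq hq]
  have hrep : ∀ p : Fin n, (representative l p : ℕ) < l := by
    intro p
    unfold representative
    split_ifs with h
    · exact h
    · exact hl
  have h1 : T.SamePart (i p) (i q) ↔
      T.SamePart (i (representative l p)) (i (representative l q)) :=
    ⟨fun h => ((hT.samePart_representative hl p).trans h).trans
      (hT.samePart_representative hl q).symm,
      fun h => ((hT.samePart_representative hl p).symm.trans h).trans
      (hT.samePart_representative hl q)⟩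
  rw [h1, ← cutsAbove_representative l _ p, ← cutsAbove_representative l _ q]
  rcases lt_trichotomy (representative l p) (representative l q) with h | h | h
  · exact key _ _ h (hrep q)
  · rw [h]
    exact iff_of_true (SamePart.refl T _) rfl
  · rw [eq_comm, ← key _ _ h (hrep p)]
    exact ⟨SamePart.symm, SamePart.symm⟩

/-- Each part has exactly one position below `l` that is not joined, its leftmost one. That position
is below `l` because positions from `l` on share the part of position `0`, which itself is never
joined. -/
lemma Oriented.size_add_card_joined (hT : T.Oriented i l) (hl : 1 ≤ l) (hln : l ≤ n) :
    T.size + (T.joined i l).card = l := by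
  have hR : (Finset.univ.filter fun p : Fin n => (p : ℕ) < l).card = l := by
    rw [Fin.card_filter_val_lt, min_eq_right hln]
  have hsub : T.joined i l ⊆ Finset.univ.filter fun p : Fin n => (p : ℕ) < l := fun b hb => by
    simpa using (mem_joints.1 hb).1
  have himg : T.support.parts = ((Finset.univ.filter fun p : Fin n => (p : ℕ) < l) \
      T.joined i l).image fun p => T.support.part (i p) := by
    ext J
    rw [Finset.mem_image]
    constructor
    · intro hJ
      have hne : (J.map i.symm.toEmbedding).Nonempty :=
        (T.support.nonempty_of_mem_parts hJ).map
      obtain ⟨p, hp, hmin⟩ : ∃ p, i p ∈ J ∧ ∀ q, i q ∈ J → p ≤ q := by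
        refine ⟨(J.map i.symm.toEmbedding).min' hne, ?_, fun q hq =>
          Finset.min'_le _ q (by simpa using hq)⟩
        have := Finset.min'_mem _ hne
        rw [Finset.mem_map_equiv] at this
        exact this
      have hpart : ∀ q, T.SamePart (i q) (i p) → i q ∈ J := fun q hq => by
        rw [samePart_iff, T.support.part_eq_of_mem hJ hp] at hq
        rw [← hq, T.support.mem_part_self]
        exact Finset.mem_univ _
      refine ⟨p, ?_, T.support.part_eq_of_mem hJ hp⟩
      rw [Finset.mem_sdiff, Finset.mem_filter]
      refine ⟨⟨Finset.mem_univ p, ?_⟩, fun hpj => ?_⟩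
      · by_contra hpl
        have h := hmin _ (hpart _ (hT.samePart_representative hl p))
        rw [representative, if_neg hpl, Fin.le_def] at h
        simp only at h
        omega
      · obtain ⟨-, g, hg, hgp⟩ := mem_joints.1 hpj
        have := hmin g (hpart g hgp)
        rw [Fin.le_def] at this
        omega
    · rintro ⟨p, -, rfl⟩
      exact T.support.part_mem.2 (Finset.mem_univ _)
  have hinj : ∀ p q : Fin n, p < q → (q : ℕ) < l → q ∉ T.joined i l →
      T.support.part (i p) ≠ T.support.part (i q) := by
    intro p q hpq hq hqj h
    rw [← samePart_iff, hT.samePart_iff_forall hpq hq] at h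
    exact hqj (h q hpq le_rfl)
  rw [size, himg, Finset.card_image_of_injOn, Finset.card_sdiff_of_subset hsub, hR]
  · have := Finset.card_le_card hsub
    omega
  · intro p hp q hq h
    simp only [Finset.coe_sdiff, Set.mem_sdiff, Finset.mem_coe, Finset.mem_filter, Finset.mem_univ,
      true_and] at hp hq
    rcases lt_trichotomy p q with hpq | hpq | hpq
    · exact absurd h (hinj p q hpq hq.1 hq.2)
    · exact hpq
    · exact absurd h.symm (hinj q p hpq hp.1 hp.2)

lemma Compatible.symm_lt {w : Equiv.Perm (Fin n)} (h : T.Compatible w) {a b : Fin n}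
    (hab : T.Lt a b) : w.symm a < w.symm b := by
  refine lt_of_le_of_ne (not_lt.1 fun hba => h a b hba hab) fun e => ?_
  obtain ⟨J, hJ⟩ := hab
  exact hJ.ne (w.symm.injective e)

/-- A composite set partition into singlets is determined by its support and a linear extension. -/
lemma ext_of_compatible {S T : CompositeSetPartition n} {w : Equiv.Perm (Fin n)}
    (hS : S.AllSinglets) (hT : T.AllSinglets) (hSw : S.Compatible w) (hTw : T.Compatible w)
    (h : S.support = T.support) : S = T := by
  have hS' : S.part = fun J : S.support.parts => restrictPerm w (J : Finset (Fin n)) := by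
    funext J
    exact eq_restrictPerm (hS J) fun a b hab => hSw.symm_lt ⟨J, hab⟩
  have hT' : T.part = fun J : T.support.parts => restrictPerm w (J : Finset (Fin n)) := by
    funext J
    exact eq_restrictPerm (hT J) fun a b hab => hTw.symm_lt ⟨J, hab⟩
  obtain ⟨s, p⟩ := S
  obtain ⟨t, q⟩ := T
  dsimp only at h hS' hT'
  subst h
  rw [hS', hT']

open Classical in
/-- The composite set partition with the given joints, its parts being ordered by `w`. -/
noncomputable def ofJoints (w i : Equiv.Perm (Fin n)) (l : ℕ) (E : Finset (Fin n)) :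
    CompositeSetPartition n where
  support := Finpartition.ofSetoid (Setoid.ker fun a => cutsAbove l E (i.symm a))
  part J := restrictPerm w J

lemma ofJoints_samePart_iff (w i : Equiv.Perm (Fin n)) (l : ℕ) (E : Finset (Fin n)) (p q : Fin n) :
    (ofJoints w i l E).SamePart (i p) (i q) ↔ cutsAbove l E p = cutsAbove l E q := by
  classical
  rw [samePart_iff, eq_comm,
    ← Finpartition.mem_part_iff_part_eq_part _ (Finset.mem_univ _) (Finset.mem_univ _)]
  refine (Finpartition.mem_part_ofSetoid_iff_rel).trans ?_
  rw [Setoid.ker_def]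
  simp

lemma ofJoints_lt_iff (w i : Equiv.Perm (Fin n)) (l : ℕ) (E : Finset (Fin n)) (a b : Fin n) :
    (ofJoints w i l E).Lt a b ↔ (ofJoints w i l E).SamePart a b ∧ w.symm a < w.symm b := by
  constructor
  · intro h
    refine ⟨h.samePart, ?_⟩
    obtain ⟨J, hJ⟩ := h
    exact symm_lt_of_restrictPerm_lt hJ
  · rintro ⟨⟨J, hJ, ha, hb⟩, h⟩
    exact ⟨⟨J, hJ⟩, restrictPerm_lt ha hb h⟩

lemma ofJoints_allSinglets (w i : Equiv.Perm (Fin n)) (l : ℕ) (E : Finset (Fin n)) :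
    (ofJoints w i l E).AllSinglets :=
  fun _ => restrictPerm_allSinglets _ _

lemma ofJoints_compatible (w i : Equiv.Perm (Fin n)) (l : ℕ) (E : Finset (Fin n)) :
    (ofJoints w i l E).Compatible w := fun a b h hab =>
  h.asymm ((ofJoints_lt_iff w i l E a b).1 hab).2

/-- The labels `i_1, i_{l+1}, …, i_n` are in this order in `(w₁, …, wₙ)`. -/
def TailOrdered (w i : Equiv.Perm (Fin n)) (l : ℕ) : Prop :=
  ∀ a b : Fin n, a < b → ((a : ℕ) = 0 ∨ l ≤ (a : ℕ)) → l ≤ (b : ℕ) → w.symm (i a) < w.symm (i b)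

/-- The positions `b < l` at which `(i_1, …, i_l)` is ascending for the order `(w₁, …, wₙ)`. -/
noncomputable def ascents (w i : Equiv.Perm (Fin n)) (l : ℕ) : Finset (Fin n) :=
  joints l fun g b => w.symm (i g) < w.symm (i b)

/-- Within a run the ascents of `w` chain together. Positions from `l` on have representative `0`,
hence lie in the part of i_1, where `TailOrdered` gives the order. -/
lemma ofJoints_oriented {w i : Equiv.Perm (Fin n)} {l : ℕ} {E : Finset (Fin n)}
    (hE : E ⊆ ascents w i l) (hw : TailOrdered w i l) : (ofJoints w i l E).Oriented i l := by
  constructor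
  · intro a b hab hb h
    have h' := (cutsAbove_eq_iff hab hb).1 ((ofJoints_samePart_iff w i l E a b).1 h)
    have key : ∀ k, ∀ c : Fin n, (c : ℕ) = a + (k + 1) → c ≤ b → w.symm (i a) < w.symm (i c) := by
      intro k
      induction k with
      | zero =>
        intro c hc hcb
        obtain ⟨-, g, hg, hgc⟩ := mem_joints.1 (hE (h' c (by rw [Fin.lt_def]; omega) hcb))
        obtain rfl : g = a := Fin.ext (by omega)
        exact hgc
      | succ k ih =>
        intro c hc hcb
        obtain ⟨-, g, hg, hgc⟩ := mem_joints.1 (hE (h' c (by rw [Fin.lt_def]; omega) hcb))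
        exact (ih g (by omega) (by rw [Fin.le_def] at *; omega)).trans hgc
    refine ⟨(ofJoints_lt_iff w i l E _ _).2 ⟨h, key (b - a - 1) b ?_ le_rfl⟩, fun c hac hcb => ?_⟩
    · rw [Fin.lt_def] at hab
      omega
    · rw [ofJoints_samePart_iff, cutsAbove_eq_iff hac (lt_trans hcb hb)]
      exact fun d had hdc => h' d had (hdc.trans hcb.le)
  · intro a b hab ha hb
    refine (ofJoints_lt_iff w i l E _ _).2 ⟨?_, hw a b hab ha hb⟩
    have hrep : representative l a = representative l b := by
      unfold representative
      rw [if_neg (not_lt.2 hb)]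
      split_ifs with h
      · exact Fin.ext (ha.resolve_right (not_le.2 h))
      · rfl
    rw [ofJoints_samePart_iff]
    unfold cutsAbove
    rw [hrep]

lemma joined_ofJoints {w i : Equiv.Perm (Fin n)} {l : ℕ} {E : Finset (Fin n)}
    (hE : E ⊆ ascents w i l) : (ofJoints w i l E).joined i l = E := by
  have key : ∀ g b : Fin n, (b : ℕ) = g + 1 → (b : ℕ) < l →
      ((ofJoints w i l E).SamePart (i g) (i b) ↔ b ∈ E) := by
    intro g b hgb hb
    have hlt : g < b := by rw [Fin.lt_def]; omega
    rw [ofJoints_samePart_iff, cutsAbove_eq_iff hlt hb]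
    refine ⟨fun h => h b hlt le_rfl, fun h c hgc hcb => ?_⟩
    obtain rfl : c = b := by
      rw [Fin.lt_def] at hgc
      rw [Fin.le_def] at hcb
      exact Fin.ext (by omega)
    exact h
  ext b
  constructor
  · intro hb
    obtain ⟨hbl, g, hgb, h⟩ := mem_joints.1 hb
    exact (key g b hgb hbl).1 h
  · intro hb
    obtain ⟨hbl, g, hgb, -⟩ := mem_joints.1 (hE hb)
    exact mem_joints.2 ⟨hbl, g, hgb, (key g b hgb hbl).2 hb⟩

lemma Oriented.joined_subset_ascents {w : Equiv.Perm (Fin n)} (hT : T.Oriented i l)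
    (hw : T.Compatible w) : T.joined i l ⊆ ascents w i l := by
  intro b hb
  obtain ⟨hbl, g, hgb, h⟩ := mem_joints.1 hb
  exact mem_joints.2 ⟨hbl, g, hgb, hw.symm_lt (hT.1 g b (by rw [Fin.lt_def]; omega) hbl h).1⟩

lemma Oriented.tailOrdered {w : Equiv.Perm (Fin n)} (hT : T.Oriented i l) (hw : T.Compatible w) :
    TailOrdered w i l :=
  fun a b hab ha hb => hw.symm_lt (hT.2 a b hab ha hb)

lemma mem_orientedComposites : T ∈ orientedComposites i l ↔ T.AllSinglets ∧ T.Oriented i l := by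
  simp [orientedComposites]

-- Compatible oriented composites correspond to subsets of the ascents through their joints, with
-- sign given by the cardinality. The alternating sum over all subsets of a finite set vanishes
-- unless the set is empty.
open Classical in
lemma sum_compatible (w i : Equiv.Perm (Fin n)) {l : ℕ} (hl : 1 ≤ l) (hln : l ≤ n) :
    ∑ T ∈ orientedComposites i l with T.Compatible w, (-1 : ℂ) ^ ((l : ℤ) - (T.size : ℤ)) =
      if TailOrdered w i l ∧ ascents w i l = ∅ then 1 else 0 := by
  by_cases hw : TailOrdered w i l
  · have e : ∑ T ∈ orientedComposites i l with T.Compatible w,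
        (-1 : ℂ) ^ ((l : ℤ) - (T.size : ℤ)) = ∑ E ∈ (ascents w i l).powerset, (-1 : ℂ) ^ E.card := by
      refine Finset.sum_bij' (fun T _ => T.joined i l) (fun E _ => ofJoints w i l E) ?_ ?_ ?_ ?_ ?_
      · intro T hT
        rw [Finset.mem_filter, mem_orientedComposites] at hT
        exact Finset.mem_powerset.2 (hT.1.2.joined_subset_ascents hT.2)
      · intro E hE
        rw [Finset.mem_filter, mem_orientedComposites]
        exact ⟨⟨ofJoints_allSinglets w i l E, ofJoints_oriented (Finset.mem_powerset.1 hE) hw⟩,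
          ofJoints_compatible w i l E⟩
      · intro T hT
        rw [Finset.mem_filter, mem_orientedComposites] at hT
        refine ext_of_compatible (ofJoints_allSinglets _ _ _ _) hT.1.1 (ofJoints_compatible _ _ _ _)
          hT.2 (Finpartition.ext_part fun a _ b _ => ?_)
        rw [← samePart_iff, ← samePart_iff, ← i.apply_symm_apply a, ← i.apply_symm_apply b,
          ofJoints_samePart_iff, hT.1.2.samePart_iff_cutsAbove hl]
      · intro E hE
        exact joined_ofJoints (Finset.mem_powerset.1 hE)
      · intro T hT
        rw [Finset.mem_filter, mem_orientedComposites] at hT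
        have := hT.1.2.size_add_card_joined hl hln
        rw [← zpow_natCast]
        congr 1
        omega
    have h := Finset.sum_powerset_neg_one_pow_card (x := ascents w i l)
    rw [e]
    simp only [hw, true_and]
    exact_mod_cast congrArg (Int.cast : ℤ → ℂ) h
  · rw [if_neg fun h => hw h.1]
    refine Finset.sum_eq_zero fun T hT => ?_
    rw [Finset.mem_filter, mem_orientedComposites] at hT
    exact absurd (hT.1.2.tailOrdered hT.2) hw

/-- Without ascents, i_l, …, i_1 occur in this order in `w`, and the tail condition continues from
i_1 through i_{l+1}, …, i_n. Together this is a total order of the labels. -/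
lemma tailOrdered_and_ascents_iff (w i : Equiv.Perm (Fin n)) {l : ℕ} (hl : 1 ≤ l) (hln : l ≤ n) :
    TailOrdered w i l ∧ ascents w i l = ∅ ↔ w = (reverseFirst l hln).trans i := by
  have hrev : ∀ q : Fin n, ((reverseFirst l hln q : Fin n) : ℕ) =
      if (q : ℕ) < l then l - 1 - q else q := fun q => rfl
  have hsymm : (reverseFirst l hln).symm = reverseFirst l hln := rfl
  constructor
  · rintro ⟨hw, ha⟩
    have hdesc : ∀ k, ∀ p q : Fin n, (q : ℕ) = p + (k + 1) → (q : ℕ) < l →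
        w.symm (i q) < w.symm (i p) := by
      have step : ∀ p q : Fin n, (q : ℕ) = p + 1 → (q : ℕ) < l → w.symm (i q) < w.symm (i p) := by
        intro p q hpq hq
        have hne : w.symm (i q) ≠ w.symm (i p) := fun h => by
          have := congrArg Fin.val (i.injective (w.symm.injective h))
          omega
        refine lt_of_le_of_ne (not_lt.1 fun h => ?_) hne
        exact Finset.notMem_empty q (ha ▸ mem_joints.2 ⟨hq, p, hpq, h⟩)
      intro k
      induction k with
      | zero => exact step
      | succ k ih =>
        intro p q hpq hq
        exact (step ⟨p + (k + 1), by omega⟩ q (by simp only; omega) hq).trans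
          (ih p _ rfl (by simp only; omega))
    have hmono : StrictMono fun q => w.symm (i (reverseFirst l hln q)) := by
      intro q r hqr
      rw [Fin.lt_def] at hqr
      have h1 := hrev q
      have h2 := hrev r
      by_cases hr : (r : ℕ) < l
      · rw [if_pos (by omega)] at h1 h2
        exact hdesc (r - q - 1) _ _ (by omega) (by omega)
      · rw [if_neg hr] at h2
        by_cases hq : (q : ℕ) < l
        · rw [if_pos hq] at h1
          -- A label of the reversed segment and a label of the tail are compared through i_1, at
          -- position `0`.
          have h0 : w.symm (i ⟨0, q.pos⟩) < w.symm (i (reverseFirst l hln r)) :=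
            hw _ _ (by rw [Fin.lt_def]; simp only; omega) (Or.inl rfl) (by omega)
          refine lt_of_le_of_lt ?_ h0
          by_cases hz : ((reverseFirst l hln q : Fin n) : ℕ) = 0
          · exact (congrArg (fun t => w.symm (i t)) (Fin.ext hz)).le
          · exact (hdesc ((reverseFirst l hln q : Fin n) - 1) _ _ (by simp only; omega)
              (by omega)).le
        · rw [if_neg hq] at h1
          exact hw _ _ (by rw [Fin.lt_def]; omega) (Or.inr (by omega)) (by omega)
    -- The only order automorphism of `Fin n` is the identity.
    have hid : ((reverseFirst l hln).trans i).trans w.symm = Equiv.refl _ := by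
      have := Subsingleton.elim
        (StrictMono.orderIsoOfSurjective _ hmono
          (((reverseFirst l hln).trans i).trans w.symm).surjective) (OrderIso.refl (Fin n))
      ext q
      exact congrArg Fin.val (DFunLike.congr_fun this q)
    ext q
    have := DFunLike.congr_fun hid q
    simp only [Equiv.trans_apply, Equiv.refl_apply, Equiv.symm_apply_eq] at this
    rw [Equiv.trans_apply, this]
  · rintro rfl
    have hval : ∀ p, ((reverseFirst l hln).trans i).symm (i p) = reverseFirst l hln p := by
      intro p
      rw [Equiv.symm_trans_apply, i.symm_apply_apply, hsymm]
    constructor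
    · intro a b hab ha hb
      rw [hval, hval, Fin.lt_def, hrev, hrev]
      rw [Fin.lt_def] at hab
      split_ifs <;> omega
    · refine Finset.eq_empty_of_forall_notMem fun b hb => ?_
      obtain ⟨hbl, g, hgb, h⟩ := mem_joints.1 hb
      rw [hval, hval, Fin.lt_def, hrev, hrev] at h
      split_ifs at h <;> omega

end CompositeSetPartition

end Cuts

/-! ### Standardness and the two identities -/

section Main

variable {n : ℕ}

/-- Any other label in the first block would have a later position, and the orientation puts the
minimal label strictly to its left. If that other label is in the tail, i_1 lies in the same part,
so the minimal position is `0`. -/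
lemma CompositeSetPartition.Oriented.isStandard {T : CompositeSetPartition n}
    {i : Equiv.Perm (Fin n)} {l : ℕ} (hT : T.Oriented i l) : T.IsStandard i := by
  intro J a ha hmin
  refine ⟨(T.part J).len_pos ⟨_, ha⟩, ?_⟩
  obtain ⟨q, hq⟩ := ((T.part J).union _).1 ha
  obtain ⟨c, hc⟩ := (T.part J).nonempty ⟨0, (T.part J).len_pos ⟨_, ha⟩⟩
  have hcJ := ((T.part J).union c).2 ⟨_, hc⟩
  obtain ⟨b, rfl⟩ := i.surjective c
  rcases (hmin b hcJ).eq_or_lt with rfl | hab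
  · exact hc
  exfalso
  have hlt : T.Lt (i a) (i b) := by
    by_cases hb : (b : ℕ) < l
    · exact (hT.1 a b hab hb ⟨J, J.2, ha, hcJ⟩).1
    · refine hT.2 a b hab (Or.inl ?_) (not_lt.1 hb)
      have h0 := hT.2 ⟨0, a.pos⟩ b (by rw [Fin.lt_def]; simp only; omega) (Or.inl rfl) (not_lt.1 hb)
      obtain ⟨K, hK, h0K, hbK⟩ := h0.samePart
      obtain rfl := T.part_unique hK J.2 hbK hcJ
      have := hmin _ h0K
      rw [Fin.le_def] at this
      simpa using this
  rw [T.lt_iff_of_mem J ha] at hlt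
  obtain ⟨r, s, hrs, -, hs⟩ := hlt
  rw [(T.part J).eq_of_mem_block hs hc, Fin.lt_def] at hrs
  exact absurd hrs (Nat.not_lt_zero _)

lemma OrderedSetPartition.Oriented.isStandard
    {P : OrderedSetPartition (Finset.univ : Finset (Fin n))}
    {i : Equiv.Perm (Fin n)} {l : ℕ} (hP : P.Oriented i l) : P.IsStandard i := by
  intro a ha hmin
  refine ⟨P.len_pos ⟨_, ha⟩, ?_⟩
  obtain ⟨c, hc⟩ := P.nonempty ⟨0, P.len_pos ⟨_, ha⟩⟩
  obtain ⟨b, rfl⟩ := i.surjective c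
  rcases (hmin b (Finset.mem_univ _)).eq_or_lt with rfl | hab
  · exact hc
  exfalso
  have ha0 : (a : ℕ) = 0 := by
    have := hmin ⟨0, a.pos⟩ (Finset.mem_univ _)
    rw [Fin.le_def] at this
    simpa using this
  have hlt : P.Lt (i a) (i b) := by
    by_cases hb : (b : ℕ) < l
    · exact hP.1 a b hab hb
    · exact hP.2 a b hab (Or.inl ha0) (not_lt.1 hb)
  obtain ⟨r, s, hrs, -, hs⟩ := hlt
  rw [P.eq_of_mem_block hs hc, Fin.lt_def] at hrs
  exact absurd hrs (Nat.not_lt_zero _)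

lemma mem_orientedPartitions {P : OrderedSetPartition (Finset.univ : Finset (Fin n))}
    {i : Equiv.Perm (Fin n)} {l : ℕ} :
    P ∈ orientedPartitions i l ↔ P.AllSinglets ∧ P.Oriented i l := by
  simp [orientedPartitions]

/-- The identity for the plate of a valley, modulo the lumped plates. -/
lemma valley_sub_sum_mem (i : Equiv.Perm (Fin n)) {l : ℕ} (hl : 1 ≤ l) (hln : l ≤ n) :
    (valley i l hln).coneFun - ∑ T ∈ orientedComposites i l,
      (-1 : ℂ) ^ ((l : ℤ) - (T.size : ℤ)) • convolution T ∈ lumpedSpan Finset.univ := by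
  classical
  have h : ∑ T ∈ orientedComposites i l, (-1 : ℂ) ^ ((l : ℤ) - (T.size : ℤ)) •
      (convolution T - ∑ w : Equiv.Perm (Fin n) with T.Compatible w,
        (OrderedSetPartition.ofPerm w).coneFun) ∈ lumpedSpan Finset.univ :=
    Submodule.sum_mem _ fun T hT => Submodule.smul_mem _ _
      (T.convolution_sub_mem (CompositeSetPartition.mem_orientedComposites.1 hT).1)
  -- After exchanging the two sums, each permutation carries the coefficient from `sum_compatible`,
  -- which singles out the valley.
  have e : ∑ T ∈ orientedComposites i l, (-1 : ℂ) ^ ((l : ℤ) - (T.size : ℤ)) •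
      ∑ w : Equiv.Perm (Fin n) with T.Compatible w, (OrderedSetPartition.ofPerm w).coneFun =
      (valley i l hln).coneFun := by
    simp only [Finset.sum_filter, Finset.smul_sum]
    rw [Finset.sum_comm]
    have : ∀ w : Equiv.Perm (Fin n), ∑ T ∈ orientedComposites i l,
        (-1 : ℂ) ^ ((l : ℤ) - (T.size : ℤ)) •
          (if T.Compatible w then (OrderedSetPartition.ofPerm w).coneFun else 0) =
        if w = (reverseFirst l hln).trans i then (OrderedSetPartition.ofPerm w).coneFun else 0 := by
      intro w
      simp only [smul_ite, smul_zero]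
      rw [← Finset.sum_filter, ← Finset.sum_smul,
        CompositeSetPartition.sum_compatible w i hl hln, ite_smul, one_smul, zero_smul]
      exact if_congr (CompositeSetPartition.tailOrdered_and_ascents_iff w i hl hln) rfl rfl
    rw [Finset.sum_congr rfl fun w _ => this w, Finset.sum_ite_eq', if_pos (Finset.mem_univ _)]
    rfl
  rw [← neg_mem_iff]
  simp only [smul_sub, Finset.sum_sub_distrib] at h
  rwa [e, ← neg_sub] at h

/-- The composite set partition with a single part. -/
noncomputable def CompositeSetPartition.ofPartition (hn : n ≠ 0)
    (P : OrderedSetPartition (Finset.univ : Finset (Fin n))) : CompositeSetPartition n where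
  support := Finpartition.indiscrete (by
    rw [Finset.bot_eq_empty, ← Finset.nonempty_iff_ne_empty]
    exact ⟨⟨0, Nat.pos_of_ne_zero hn⟩, Finset.mem_univ _⟩)
  part J :=
    { len := P.len
      block := P.block
      nonempty := P.nonempty
      disjoint := P.disjoint
      union := fun a => by
        rw [Finset.mem_singleton.1 J.2]
        exact P.union a }

namespace CompositeSetPartition

variable (hn : n ≠ 0) (P : OrderedSetPartition (Finset.univ : Finset (Fin n)))

lemma univ_mem_ofPartition : Finset.univ ∈ (ofPartition hn P).support.parts :=
  Finset.mem_singleton_self _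

lemma ofPartition_lt_iff (a b : Fin n) : (ofPartition hn P).Lt a b ↔ P.Lt a b :=
  ⟨fun ⟨_, h⟩ => h, fun h => ⟨⟨_, univ_mem_ofPartition hn P⟩, h⟩⟩

lemma ofPartition_oriented_iff (i : Equiv.Perm (Fin n)) (l : ℕ) :
    (ofPartition hn P).Oriented i l ↔ P.Oriented i l := by
  have hS : ∀ a b, (ofPartition hn P).SamePart a b := fun a b =>
    ⟨_, univ_mem_ofPartition hn P, Finset.mem_univ a, Finset.mem_univ b⟩
  unfold Oriented OrderedSetPartition.Oriented
  simp only [ofPartition_lt_iff, hS, true_imp_iff, implies_true, and_true]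

lemma ofPartition_allSinglets_iff : (ofPartition hn P).AllSinglets ↔ P.AllSinglets :=
  ⟨fun h => h ⟨_, univ_mem_ofPartition hn P⟩, fun h _ => h⟩

lemma ofPartition_size : (ofPartition hn P).size = 1 :=
  Finset.card_singleton _

lemma ofPartition_injective : Function.Injective (ofPartition hn) := by
  intro P Q h
  simp only [ofPartition, mk.injEq, true_and, heq_eq_eq] at h
  have h := congrFun h ⟨_, univ_mem_ofPartition hn P⟩
  simp only [OrderedSetPartition.mk.injEq] at h
  exact OrderedSetPartition.ext h.1 h.2

lemma exists_ofPartition_eq {T : CompositeSetPartition n} (hT : T.size = 1) :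
    ∃ P, ofPartition hn P = T := by
  obtain ⟨J, hJ⟩ := Finset.card_eq_one.1 hT
  obtain ⟨s, p⟩ := T
  dsimp only at hJ
  obtain rfl : J = Finset.univ := by
    have := s.biUnion_parts
    rwa [hJ, Finset.singleton_biUnion] at this
  have hs : s = Finpartition.indiscrete (by
      rw [Finset.bot_eq_empty, ← Finset.nonempty_iff_ne_empty]
      exact ⟨⟨0, Nat.pos_of_ne_zero hn⟩, Finset.mem_univ _⟩) := Finpartition.ext hJ
  subst hs
  refine ⟨p ⟨Finset.univ, Finset.mem_singleton_self _⟩, ?_⟩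
  unfold ofPartition
  congr 1
  funext ⟨J, hJ'⟩
  obtain rfl := Finset.mem_singleton.1 hJ'
  rfl

lemma convolution_ofPartition : convolution (ofPartition hn P) = P.coneFun := by
  rw [convolution_eq_prod, Fintype.prod_eq_single ⟨_, univ_mem_ofPartition hn P⟩]
  · rfl
  · intro K hK
    exact absurd (Subtype.ext (Finset.mem_singleton.1 K.2)) hK

end CompositeSetPartition

end Main

theorem corollary6p4 (n l : ℕ) (hl : 1 ≤ l) (hln : l ≤ n) (i : Equiv.Perm (Fin n)) :
    (∀ T ∈ orientedComposites i l, T.IsStandard i) ∧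
    (∀ P ∈ orientedPartitions i l, P.IsStandard i) ∧
    (∃ mem : ∀ T : CompositeSetPartition n, convolution T ∈ PHat n,
      (Submodule.Quotient.mk (plateFun (valley i l hln)) : PHatOne n) =
        ∑ T ∈ orientedComposites i l,
          (-1 : ℂ) ^ ((l : ℤ) - (T.size : ℤ)) •
            (Submodule.Quotient.mk ⟨convolution T, mem T⟩ : PHatOne n)) ∧
    (Submodule.Quotient.mk (plateFun (valley i l hln)) : POne n) =
      (-1 : ℂ) ^ (l - 1) •
        ∑ P ∈ orientedPartitions i l, (Submodule.Quotient.mk (plateFun P) : POne n) := by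
  classical
  have key : plateFun (valley i l hln) - ∑ T ∈ orientedComposites i l,
      (-1 : ℂ) ^ ((l : ℤ) - (T.size : ℤ)) • (⟨convolution T, T.convolution_mem⟩ : PHat n) ∈
      nonPointedSpan n := by
    refine mem_nonPointedSpan ?_
    have h := valley_sub_sum_mem i hl hln
    rw [← (valley i l hln).charFn_plate] at h
    simpa [plateFun] using h
  refine ⟨fun T hT => (CompositeSetPartition.mem_orientedComposites.1 hT).2.isStandard,
    fun P hP => (mem_orientedPartitions.1 hP).2.isStandard,
    ⟨fun T => T.convolution_mem, ?_⟩, ?_⟩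
  · have h := (Submodule.Quotient.eq (nonPointedSpan n)).2 key
    rw [h, ← Submodule.mkQ_apply, map_sum]
    simp only [map_smul, Submodule.mkQ_apply]
  · have h := (Submodule.Quotient.eq (nonPointedSpan n ⊔ nullSpan n)).2
      (Submodule.mem_sup_left key)
    have hn : n ≠ 0 := by omega
    rw [h, ← Submodule.mkQ_apply, map_sum, Finset.smul_sum]
    simp only [map_smul, Submodule.mkQ_apply]
    have hnull : ∀ T : CompositeSetPartition n, T.size ≠ 1 →
        (Submodule.Quotient.mk ⟨convolution T, T.convolution_mem⟩ : POne n) = 0 := fun T hT =>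
      (Submodule.Quotient.mk_eq_zero _).2 (Submodule.mem_sup_right
        (T.convolution_ae_eq_zero hT (Nat.pos_of_ne_zero hn)))
    -- Products with several factors are null functions, so only the composites with a single part
    -- remain.
    rw [← Finset.sum_filter_of_ne (p := fun T => T.size = 1) fun T _ hT => by
      by_contra hsize
      exact hT (by rw [hnull T hsize, smul_zero])]
    symm
    refine Finset.sum_bij (fun P _ => CompositeSetPartition.ofPartition hn P) ?_ ?_ ?_ ?_
    · intro P hP
      rw [mem_orientedPartitions] at hP
      rw [Finset.mem_filter, CompositeSetPartition.mem_orientedComposites]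
      exact ⟨⟨(CompositeSetPartition.ofPartition_allSinglets_iff hn P).2 hP.1,
        (CompositeSetPartition.ofPartition_oriented_iff hn P i l).2 hP.2⟩,
        CompositeSetPartition.ofPartition_size hn P⟩
    · exact fun P _ Q _ h => CompositeSetPartition.ofPartition_injective hn h
    · intro T hT
      rw [Finset.mem_filter, CompositeSetPartition.mem_orientedComposites] at hT
      obtain ⟨P, rfl⟩ := CompositeSetPartition.exists_ofPartition_eq hn hT.2
      refine ⟨P, mem_orientedPartitions.2 ?_, rfl⟩
      exact ⟨(CompositeSetPartition.ofPartition_allSinglets_iff hn P).1 hT.1.1,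
        (CompositeSetPartition.ofPartition_oriented_iff hn P i l).1 hT.1.2⟩
    · intro P _
      -- For m = 1 the integer exponent is `l - 1`; truncated subtraction agrees with it because `1
      -- ≤ l`.
      have hz : ((l : ℤ) - ((CompositeSetPartition.ofPartition hn P).size : ℤ)) =
          ((l - 1 : ℕ) : ℤ) := by
        rw [CompositeSetPartition.ofPartition_size]
        omega
      rw [hz, zpow_natCast]
      congr 2
      exact Subtype.ext (P.charFn_plate.trans
        (CompositeSetPartition.convolution_ofPartition hn P).symm)
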